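/- Let \(\phi(z)=\sum_{n\ge 1}\phi_n z^n\) be a real power series with \(\phi(0)=0\), and let \(f(z)=z(1-\phi(z))=\sum_{n\ge1}f_nz^n\). For \(0<q<1\), let \(g(z)=\sum_{n\ge 1} g_n z^n\) be the formal power series with zero constant term such that \[ \sum_{n\ge 1} f_n\, g(z)g(z/q)\cdots g(z/q^{n-1})=z . \] (It exists and is unique, and \(q^{\binom n2}g_n\) is a polynomial in \(q\) for every \(n\); both facts are part of the assertion.) Assume that (i) \(\phi_i\ge 0\) for all \(i\ge 1\); (ii) \(\zeta=\min\{x>0:\ \phi(x)=1\}\) exists (the series \(\phi(x)\) being required to converge); (iii) for every integer \(j\ge 0\), \(\lim_{n\to\infty}\phi_{n+j}/\phi_n\) exists in \([0,\infty)\) (with the convention \(0/0=0\), so that polynomials \(\phi\) are admitted); (iv) the sequence \(u_n=[z^n]\,\dfrac{1}{1-\phi(\zeta z)}\) is regularly varying of index \(\rho-1\) for some \(\rho\in(0,1]\), that is, \(u_{\lfloor ct\rfloor}/u_{\lfloor t\rfloor}\to c^{\rho-1}\) as \(t\to\infty\) for every \(c>0\). For \(n\ge1\) consider the polynomials in \(q\)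 \[ a_n(q)=\zeta^n\, n\,\Bigl(1-\phi\bigl(\zeta(1-\tfrac1n)\bigr)\Bigr)\,q^{\binom n2}\,g_n . \] Then, for \(0<q<1\), the product \(\prod_{j\ge1}(1-\phi(\zeta q^j))\) converges to a positive number, the function \[ L(q)=\frac{\zeta}{\Gamma(\rho)\prod_{j\ge 1}\bigl(1-\phi(\zeta q^j)\bigr)} \] is the sum of a power series in \(q\) that converges on \((0,1)\), and \(a_n\) converges to \(L\) in each of the following three senses: (a) \(\liminf_{n\to\infty}a_n(q)=L(q)\) for every \(q\in(0,1)\); (b) for every \(q\in(0,1)\) and \(\delta>0\), \(\displaystyle\lim_{n\to\infty}\frac1n\,\#\{1\le i\le n:\ |a_i(q)-L(q)|\ge\delta\}=0\); (c) for every integer \(j\ge0\), \([q^j]a_n\to[q^j]L\) as \(n\to\infty\). -/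

import Mathlib

open Filter Topology
open scoped Polynomial PowerSeries

noncomputable section

/-- The value `h(x) = ∑ₙ hₙ xⁿ` of a real power series at a real point. It is used only where the
series converges. -/
def psValue (h : ℝ⟦X⟧) (x : ℝ) : ℝ :=
  ∑' n : ℕ, PowerSeries.coeff n h * x ^ n

/-- `g` is the right inverse of `f` (a power series without constant term) for the `q`-Lagrange
inversion: `g` has no constant term and
`∑_{n ≥ 1} fₙ g(z) g(z/q) ⋯ g(z/q^{n-1}) = z` as formal power series.
The identity is read coefficient by coefficient. As `g` has no constant term, the `n`-th product
is divisible by `zⁿ`, so that only the terms with `n ≤ m` contribute to the coefficient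
of `z^m`. -/
def IsQRightInverse (q : ℝ) (f g : ℝ⟦X⟧) : Prop :=
  PowerSeries.constantCoeff g = 0 ∧
    ∀ m : ℕ,
      ∑ n ∈ Finset.Icc 1 m,
        PowerSeries.coeff n f *
          PowerSeries.coeff m (∏ k ∈ Finset.range n, PowerSeries.rescale ((q ^ k)⁻¹) g) =
      PowerSeries.coeff m (PowerSeries.X : ℝ⟦X⟧)

/-- A function on the half-line is regularly varying at infinity of index `α` if
`h(c t) / h(t) → c ^ α` as `t → ∞`, for every `c > 0`. -/
def IsRegularlyVarying (h : ℝ → ℝ) (α : ℝ) : Prop :=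
  ∀ c : ℝ, 0 < c → Tendsto (fun t : ℝ => h (c * t) / h t) atTop (𝓝 (c ^ α))

/-- A sequence is regularly varying if the function equal to `u n` on `[n, n + 1)` is. -/
def IsRegularlyVaryingSeq (u : ℕ → ℝ) (α : ℝ) : Prop :=
  IsRegularlyVarying (fun t : ℝ => u ⌊t⌋₊) α

/-- Convergence in limit infimum on `A`: `liminf aₙ(q) = L(q)` for every `q ∈ A`. The limit infimum
is taken in the extended reals. -/
def ConvergesLiminf (a : ℕ → ℝ[X]) (L : ℝ⟦X⟧) (A : Set ℝ) : Prop :=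
  ∀ q ∈ A, liminf (fun n : ℕ => (((a n).eval q : ℝ) : EReal)) atTop = ((psValue L q : ℝ) : EReal)

open Classical in
/-- Convergence on `A` except on a set of integers of density `0`: for every `δ > 0` and `q ∈ A`,
the proportion of the `1 ≤ i ≤ n` with `|aᵢ(q) - L(q)| ≥ δ` tends to `0`. -/
def ConvergesOffDensityZero (a : ℕ → ℝ[X]) (L : ℝ⟦X⟧) (A : Set ℝ) : Prop :=
  ∀ δ : ℝ, 0 < δ → ∀ q ∈ A,
    Tendsto
      (fun n : ℕ => (1 / (n : ℝ)) *
        ∑ i ∈ Finset.Icc 1 n, if δ ≤ |(a i).eval q - psValue L q| then (1 : ℝ) else 0)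
      atTop (𝓝 0)

/-- Coefficientwise convergence: `[q^j] aₙ → [q^j] L` for every `j`. -/
def ConvergesCoeffwise (a : ℕ → ℝ[X]) (L : ℝ⟦X⟧) : Prop :=
  ∀ j : ℕ, Tendsto (fun n : ℕ => (a n).coeff j) atTop (𝓝 (PowerSeries.coeff j L))

end

/-! Put `ψ(z) = φ(ζz)`, whose nonnegative coefficients sum to 1, and `uₙ = [zⁿ] 1/(1 - ψ)`. For `f =
z(1 - φ)`, the numbers `bₙ = q^(n choose 2) gₙ` satisfy `∑ bₖ zᵏ (1 - φ(z)) ⋯ (1 - φ(q^(k-1)z)) =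
z`, a triangular system with polynomial entries in `q`. It says that `g` is a left inverse of `f`
for `q`-composition, and `sum_coeff_prod_rescale_inv` turns left inverses into right ones.

The heart is the formal product `H(w) = 1/∏_{i≥0} (1 - ψ(qⁱw)) = ∑ cₙwⁿ`, which satisfies `H(w)(1 -
ψ(w)) = H(qw)`. For `ψ` in place of `φ`, multiplying the identity for the `bₖ` by `H` telescopes
each product into `H(qᵏw)`. Comparing coefficients gives `b_{n+1} = cₙ` minus terms that each carry
at least a factor `qⁿ` (`qInv_succ`). On the other side `H(w) = H(qw)/(1 - ψ(w))` gives `cₙ = ∑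
u_{n-i} qⁱ cᵢ`. Since `u_{n+1}/uₙ → 1`, dominated convergence yields `cₙ/uₙ → ∑ cᵢqⁱ = H(q) =
1/∏_{j≥1} (1 - ψ(qʲ))`, and `bₙ/uₙ` has the same limit (`tendsto_qInv_div`).

Karamata's Abelian theorem gives `n(1 - ψ(1 - 1/n)) uₙ → 1/Γ(ρ)` (`tendsto_norming`). So `aₙ(q) →
L(q)` in the ordinary sense for each `q` in `(0, 1)`, which implies (a) and (b). For (c), the same
two recursions are read over `ℝ⟦X⟧` with `q = X`, where only finitely many terms reach a given
coefficient. This is why `qInv` and `qRenewal` are defined over any commutative ring. -/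

noncomputable section

/-! ### Formal `q`-powers and `q`-composition. -/

/-- The `q`-analogue `f(z) f(qz) ⋯ f(q^{n-1}z)` of the `n`-th power of `f`. -/
def qPow {R : Type*} [CommRing R] (q : R) (f : R⟦X⟧) (n : ℕ) : R⟦X⟧ :=
  ∏ k ∈ Finset.range n, PowerSeries.rescale (q ^ k) f

/-- The `q`-composition `∑ₙ hₙ f(z) f(qz) ⋯ f(q^{n-1}z)` for `f` without constant term. -/
def qComp {R : Type*} [CommRing R] (q : R) (f h : R⟦X⟧) : R⟦X⟧ :=
  PowerSeries.mk fun m => ∑ n ∈ Finset.range (m + 1),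
    PowerSeries.coeff n h * PowerSeries.coeff m (qPow q f n)

section QComp

variable {R : Type*} [CommRing R]

theorem X_dvd_rescale {f : R⟦X⟧} (hf : PowerSeries.constantCoeff f = 0) (a : R) :
    (PowerSeries.X : R⟦X⟧) ∣ PowerSeries.rescale a f := by
  rw [PowerSeries.X_dvd_iff, ← PowerSeries.coeff_zero_eq_constantCoeff_apply,
    PowerSeries.coeff_rescale, PowerSeries.coeff_zero_eq_constantCoeff_apply, hf, mul_zero]

theorem X_pow_dvd_prod_rescale {f : R⟦X⟧} (hf : PowerSeries.constantCoeff f = 0)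
    (a : ℕ → R) (n : ℕ) :
    (PowerSeries.X : R⟦X⟧) ^ n ∣ ∏ k ∈ Finset.range n, PowerSeries.rescale (a k) f := by
  simpa using Finset.prod_dvd_prod_of_dvd (s := Finset.range n)
    (fun _ => (PowerSeries.X : R⟦X⟧)) _ fun k _ => X_dvd_rescale hf (a k)

theorem coeff_qPow_of_lt {q : R} {f : R⟦X⟧} (hf : PowerSeries.constantCoeff f = 0) {m n : ℕ}
    (h : m < n) : PowerSeries.coeff m (qPow q f n) = 0 :=
  PowerSeries.X_pow_dvd_iff.1 (X_pow_dvd_prod_rescale hf _ n) m h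

theorem rescale_C' (a r : R) :
    PowerSeries.rescale a (PowerSeries.C r : R⟦X⟧) = PowerSeries.C r := by
  ext n
  rw [PowerSeries.coeff_rescale, PowerSeries.coeff_C]
  split_ifs with h <;> simp [h]

theorem rescale_rescale_pow (q : R) (k : ℕ) (f : R⟦X⟧) :
    PowerSeries.rescale q (PowerSeries.rescale (q ^ k) f) = PowerSeries.rescale (q ^ (k + 1)) f := by
  rw [PowerSeries.rescale_rescale, pow_succ]

theorem qPow_succ (q : R) (f : R⟦X⟧) (n : ℕ) :
    qPow q f (n + 1) = f * PowerSeries.rescale q (qPow q f n) := by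
  simp only [qPow]
  rw [Finset.prod_range_succ', map_prod, mul_comm]
  simp [rescale_rescale_pow]

theorem coeff_qComp_of_le {q : R} {f : R⟦X⟧} (hf : PowerSeries.constantCoeff f = 0) (h : R⟦X⟧)
    {m N : ℕ} (hN : m < N) :
    PowerSeries.coeff m (qComp q f h) = ∑ n ∈ Finset.range N,
      PowerSeries.coeff n h * PowerSeries.coeff m (qPow q f n) := by
  rw [qComp, PowerSeries.coeff_mk]
  apply Finset.sum_subset
  · intro x; simp; omega
  · intro n _ hn
    rw [coeff_qPow_of_lt hf (by simpa using hn), mul_zero]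

theorem qComp_add (q : R) (f h₁ h₂ : R⟦X⟧) :
    qComp q f (h₁ + h₂) = qComp q f h₁ + qComp q f h₂ := by
  ext m; simp [qComp, add_mul, Finset.sum_add_distrib]

theorem qComp_smul (q : R) (f h : R⟦X⟧) (a : R) :
    qComp q f (PowerSeries.C a * h) = PowerSeries.C a * qComp q f h := by
  ext m; simp [qComp, Finset.mul_sum, mul_assoc]

/-- Each `q`-power is `f(z)` times the previous one at `qz`, so a shift of `h` comes out as the
operator `F ↦ f(z) F(qz)`. -/
theorem qComp_X_mul {q : R} {f : R⟦X⟧} (hf : PowerSeries.constantCoeff f = 0) (h : R⟦X⟧) :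
    qComp q f (PowerSeries.X * h) = f * PowerSeries.rescale q (qComp q f h) := by
  ext m
  rw [coeff_qComp_of_le hf _ (Nat.lt_succ_of_lt (Nat.lt_succ_self m)),
    Finset.sum_range_succ', PowerSeries.coeff_zero_X_mul, zero_mul, add_zero,
    PowerSeries.coeff_mul]
  simp only [PowerSeries.coeff_succ_X_mul, PowerSeries.coeff_rescale]
  have : ∀ x ∈ Finset.HasAntidiagonal.antidiagonal m, PowerSeries.coeff x.1 f *
      (q ^ x.2 * PowerSeries.coeff x.2 (qComp q f h)) =
      ∑ n ∈ Finset.range (m + 1), PowerSeries.coeff n h * (PowerSeries.coeff x.1 f *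
        (q ^ x.2 * PowerSeries.coeff x.2 (qPow q f n))) := by
    intro x hx
    rw [coeff_qComp_of_le (N := m + 1) hf h (by
      have := Finset.HasAntidiagonal.mem_antidiagonal.1 hx; omega), Finset.mul_sum, Finset.mul_sum]
    exact Finset.sum_congr rfl fun n _ => by ring
  rw [Finset.sum_congr rfl this, Finset.sum_comm]
  exact Finset.sum_congr rfl fun n _ => by
    rw [qPow_succ, PowerSeries.coeff_mul, Finset.mul_sum]
    simp only [PowerSeries.coeff_rescale]

theorem qComp_X_pow_mul {q : R} {f : R⟦X⟧} (hf : PowerSeries.constantCoeff f = 0) (n : ℕ)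
    (h : R⟦X⟧) :
    qComp q f (PowerSeries.X ^ n * h) =
      qPow q f n * PowerSeries.rescale (q ^ n) (qComp q f h) := by
  induction n with
  | zero => simp [qPow]
  | succ n ih =>
    rw [pow_succ', mul_assoc, qComp_X_mul hf, ih, map_mul, rescale_rescale_pow, qPow_succ, mul_assoc]

theorem qComp_one {q : R} (f : R⟦X⟧) : qComp q f 1 = 1 := by
  ext m
  simp [qComp, PowerSeries.coeff_one, qPow]

theorem qComp_X_pow {q : R} {f : R⟦X⟧} (hf : PowerSeries.constantCoeff f = 0) (n : ℕ) :
    qComp q f (PowerSeries.X ^ n) = qPow q f n := by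
  have := qComp_X_pow_mul (q := q) hf n 1
  rwa [mul_one, qComp_one, map_one, mul_one] at this

theorem qComp_X {q : R} {f : R⟦X⟧} (hf : PowerSeries.constantCoeff f = 0) :
    qComp q f PowerSeries.X = f := by
  have := qComp_X_pow (q := q) hf 1
  simpa [qPow] using this

end QComp

/-! ### Left and right inverses for the `q`-composition. -/

section Inversion

variable {K : Type*} [Field K]

/-- If `g` is a left inverse of `f`, then `z ↦ g(z) h(z/q)` is sent by the `q`-composition with `f`
to the product of `z` with the `q`-composition of `h`. -/
theorem qComp_mul_rescale_inv {q : K} (hq : q ≠ 0) {f g : K⟦X⟧}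
    (hf : PowerSeries.constantCoeff f = 0) (hg : qComp q f g = PowerSeries.X) (h : K⟦X⟧) :
    qComp q f (g * PowerSeries.rescale q⁻¹ h) = PowerSeries.X * qComp q f h := by
  -- Congruence modulo every `X ^ N`. Writing `h = a + X h'`, the discrepancy `D` for `h'` becomes
  -- `q⁻¹ f(z) D(qz)` for `h`, and the zero of `f` at the origin gains one power of `X`.
  have key : ∀ (N : ℕ) (h : K⟦X⟧), (PowerSeries.X : K⟦X⟧) ^ N ∣
      qComp q f (g * PowerSeries.rescale q⁻¹ h) - PowerSeries.X * qComp q f h := by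
    intro N
    induction N with
    | zero => intro h; simp
    | succ N ih =>
      intro h
      obtain ⟨a, h', rfl⟩ : ∃ a h', h = PowerSeries.C a + PowerSeries.X * h' :=
        ⟨_, _, (PowerSeries.eq_X_mul_shift_add_const h).trans (add_comm _ _)⟩
      have e1 : g * PowerSeries.rescale q⁻¹ (PowerSeries.C a + PowerSeries.X * h') =
          PowerSeries.C a * g + PowerSeries.C q⁻¹ *
            (PowerSeries.X * (g * PowerSeries.rescale q⁻¹ h')) := by
        rw [map_add, map_mul, PowerSeries.rescale_X, rescale_C']
        ring
      have e2 : qComp q f (PowerSeries.C a + PowerSeries.X * h') =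
          PowerSeries.C a + f * PowerSeries.rescale q (qComp q f h') := by
        rw [qComp_add, qComp_X_mul hf, ← mul_one (PowerSeries.C a), qComp_smul, qComp_one]
      have e3 : (PowerSeries.C q⁻¹ : K⟦X⟧) * PowerSeries.rescale q PowerSeries.X =
          PowerSeries.X := by
        rw [PowerSeries.rescale_X, ← mul_assoc, ← map_mul, inv_mul_cancel₀ hq, map_one, one_mul]
      obtain ⟨r, hr⟩ := ih h'
      obtain ⟨s, hs⟩ := PowerSeries.X_dvd_iff.2 hf
      have e4 : qComp q f (g * PowerSeries.rescale q⁻¹ h') =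
          PowerSeries.X * qComp q f h' + PowerSeries.X ^ N * r := by
        rw [← hr]; ring
      rw [e1, e2, qComp_add, qComp_smul, qComp_smul, hg, qComp_X_mul hf, e4, map_add, map_mul,
        map_mul]
      refine ⟨PowerSeries.C q⁻¹ * s * PowerSeries.C (q ^ N) * PowerSeries.rescale q r, ?_⟩
      have e5 : PowerSeries.rescale q ((PowerSeries.X : K⟦X⟧) ^ N) =
          PowerSeries.C (q ^ N) * PowerSeries.X ^ N := by
        rw [map_pow, PowerSeries.rescale_X, mul_pow, map_pow]
      rw [e5]
      calc _ = f * PowerSeries.rescale q (qComp q f h') *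
            (PowerSeries.C q⁻¹ * PowerSeries.rescale q PowerSeries.X - PowerSeries.X) +
            PowerSeries.C q⁻¹ * f * (PowerSeries.C (q ^ N) * PowerSeries.X ^ N) *
              PowerSeries.rescale q r := by ring
        _ = _ := by rw [e3, sub_self, mul_zero, zero_add, hs]; ring
  ext m
  have := PowerSeries.X_pow_dvd_iff.1 (key (m + 1) h) m (Nat.lt_succ_self m)
  rwa [map_sub, sub_eq_zero] at this

theorem coeff_self_qPow {q : K} {f : K⟦X⟧} (hf : PowerSeries.constantCoeff f = 0) (n : ℕ) :
    PowerSeries.coeff n (qPow q f n) = q ^ n.choose 2 * PowerSeries.coeff 1 f ^ n := by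
  induction n with
  | zero => simp [qPow]
  | succ n ih =>
    obtain ⟨s, hs⟩ := PowerSeries.X_dvd_iff.2 hf
    obtain ⟨t, ht⟩ : (PowerSeries.X : K⟦X⟧) ^ n ∣ qPow q f n := X_pow_dvd_prod_rescale hf _ n
    have h1 : PowerSeries.coeff 1 f = PowerSeries.coeff 0 s := by
      rw [hs]; exact PowerSeries.coeff_succ_X_mul 0 s
    have h2 : PowerSeries.coeff n (qPow q f n) = PowerSeries.coeff 0 t := by
      rw [ht]; simpa using PowerSeries.coeff_X_pow_mul t n 0
    have h4 : PowerSeries.coeff 0 (s * PowerSeries.rescale q t) =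
        PowerSeries.coeff 0 s * PowerSeries.coeff 0 t := by
      simp only [PowerSeries.coeff_zero_eq_constantCoeff_apply, map_mul]
      rw [← PowerSeries.coeff_zero_eq_constantCoeff_apply (PowerSeries.rescale q t),
        PowerSeries.coeff_rescale, pow_zero, one_mul, PowerSeries.coeff_zero_eq_constantCoeff_apply]
    rw [qPow_succ, ht, hs, (PowerSeries.rescale q).map_mul, (PowerSeries.rescale q).map_pow,
      PowerSeries.rescale_X,
      show PowerSeries.X * s * ((PowerSeries.C q * PowerSeries.X) ^ n * PowerSeries.rescale q t) =
        PowerSeries.X ^ (n + 1) * (PowerSeries.C (q ^ n) * (s * PowerSeries.rescale q t)) by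
        rw [map_pow]; ring]
    have := PowerSeries.coeff_X_pow_mul
      (PowerSeries.C (q ^ n) * (s * PowerSeries.rescale q t)) (n + 1) 0
    rw [zero_add] at this
    rw [this, ← hs, h1, Nat.choose_succ_succ' n 1, Nat.choose_one_right, PowerSeries.coeff_C_mul,
      h4, ← h2, ih, h1]
    ring

/-- The matrix of `h ↦ qComp q f h` is triangular, with nonzero diagonal entries `q^(n choose 2)
f₁ⁿ`. -/
theorem qComp_injective {q : K} (hq : q ≠ 0) {f : K⟦X⟧}
    (hf : PowerSeries.constantCoeff f = 0) (hf1 : PowerSeries.coeff 1 f ≠ 0) :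
    Function.Injective (qComp q f) := by
  intro h₁ h₂ h
  ext m
  induction m using Nat.strong_induction_on with
  | _ m ih =>
    have := congrArg (PowerSeries.coeff m) h
    simp only [qComp, PowerSeries.coeff_mk, Finset.sum_range_succ] at this
    rw [Finset.sum_congr rfl fun n hn => by rw [ih n (Finset.mem_range.1 hn)]] at this
    have h3 := add_left_cancel this
    rw [coeff_self_qPow hf] at h3
    exact mul_right_cancel₀ (mul_ne_zero (pow_ne_zero _ hq) (pow_ne_zero _ hf1)) h3

theorem prod_rescale_inv_succ (q : K) (g : K⟦X⟧) (n : ℕ) :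
    ∏ k ∈ Finset.range (n + 1), PowerSeries.rescale ((q ^ k)⁻¹) g =
      g * PowerSeries.rescale q⁻¹ (∏ k ∈ Finset.range n, PowerSeries.rescale ((q ^ k)⁻¹) g) := by
  rw [Finset.prod_range_succ', map_prod, mul_comm]
  simp only [pow_zero, inv_one, PowerSeries.rescale_one, RingHom.id_apply,
    PowerSeries.rescale_rescale, pow_succ, mul_inv]

/-- A left inverse for the `q`-composition is a right inverse. -/
theorem sum_coeff_prod_rescale_inv {q : K} (hq : q ≠ 0) {f g : K⟦X⟧}
    (hf : PowerSeries.constantCoeff f = 0) (hf1 : PowerSeries.coeff 1 f ≠ 0)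
    (hg0 : PowerSeries.constantCoeff g = 0) (hg : qComp q f g = PowerSeries.X) (m : ℕ) :
    ∑ n ∈ Finset.Icc 1 m, PowerSeries.coeff n f *
      PowerSeries.coeff m (∏ k ∈ Finset.range n, PowerSeries.rescale ((q ^ k)⁻¹) g) =
      PowerSeries.coeff m (PowerSeries.X : K⟦X⟧) := by
  set G : ℕ → K⟦X⟧ := fun n => ∏ k ∈ Finset.range n, PowerSeries.rescale ((q ^ k)⁻¹) g with hG
  -- `G n = g(z) g(z/q) ⋯ g(z/q^(n-1))` is the preimage of `zⁿ`. Hence `S = ∑ fₙ Gₙ` and `z` have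
  -- the same image `f`, and injectivity gives `S = z`.
  have hT : ∀ n, qComp q f (G n) = PowerSeries.X ^ n := by
    intro n
    induction n with
    | zero => simp [hG, qComp_one]
    | succ n ih =>
      simp only [hG] at ih ⊢
      rw [prod_rescale_inv_succ, qComp_mul_rescale_inv hq hf hg, ih, pow_succ']
  have hGX : ∀ n, (PowerSeries.X : K⟦X⟧) ^ n ∣ G n := fun n => X_pow_dvd_prod_rescale hg0 _ n
  set S : K⟦X⟧ := PowerSeries.mk fun m => ∑ n ∈ Finset.range (m + 1),
    PowerSeries.coeff n f * PowerSeries.coeff m (G n) with hS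
  have hSN : ∀ N m, m < N → PowerSeries.coeff m S =
      ∑ n ∈ Finset.range N, PowerSeries.coeff n f * PowerSeries.coeff m (G n) := by
    intro N m hm
    rw [hS, PowerSeries.coeff_mk]
    apply Finset.sum_subset
    · intro x; simp; omega
    · intro n _ hn
      rw [PowerSeries.X_pow_dvd_iff.1 (hGX n) m (by simpa using hn), mul_zero]
  have hTS : qComp q f S = f := by
    ext m
    rw [coeff_qComp_of_le hf S (Nat.lt_succ_self m)]
    have : ∀ n ∈ Finset.range (m + 1),
        PowerSeries.coeff n S * PowerSeries.coeff m (qPow q f n) =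
        ∑ i ∈ Finset.range (m + 1), PowerSeries.coeff i f *
          (PowerSeries.coeff n (G i) * PowerSeries.coeff m (qPow q f n)) := by
      intro n hn
      rw [hSN (m + 1) n (Finset.mem_range.1 hn), Finset.sum_mul]
      exact Finset.sum_congr rfl fun i _ => by ring
    rw [Finset.sum_congr rfl this, Finset.sum_comm]
    have h2 : ∀ i ∈ Finset.range (m + 1), ∑ n ∈ Finset.range (m + 1), PowerSeries.coeff i f *
          (PowerSeries.coeff n (G i) * PowerSeries.coeff m (qPow q f n)) =
          PowerSeries.coeff i f * if m = i then 1 else 0 := by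
      intro i _
      rw [← Finset.mul_sum, ← coeff_qComp_of_le hf (G i) (Nat.lt_succ_self m), hT,
        PowerSeries.coeff_X_pow]
    rw [Finset.sum_congr rfl h2]
    simp
  have hSX : S = PowerSeries.X :=
    qComp_injective hq hf hf1 (by rw [hTS, qComp_X hf])
  rw [← hSX, hSN (m + 1) m (Nat.lt_succ_self m), Finset.sum_range_succ',
    PowerSeries.coeff_zero_eq_constantCoeff_apply, hf, zero_mul, add_zero]
  rw [Finset.range_eq_Ico, Finset.sum_Ico_add' (fun n => PowerSeries.coeff n f *
    PowerSeries.coeff m (G n)) 0 m 1]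
  rfl

theorem X_pow_dvd_prod_rescale_sub {R : Type*} [CommRing R] {g g' : R⟦X⟧} {m : ℕ}
    (h : (PowerSeries.X : R⟦X⟧) ^ m ∣ g - g') (a : ℕ → R) (s : Finset ℕ) :
    (PowerSeries.X : R⟦X⟧) ^ m ∣
      ∏ k ∈ s, PowerSeries.rescale (a k) g - ∏ k ∈ s, PowerSeries.rescale (a k) g' := by
  induction s using Finset.induction_on with
  | empty => simp
  | insert i s hi ih =>
    rw [Finset.prod_insert hi, Finset.prod_insert hi]
    have h1 : (PowerSeries.X : R⟦X⟧) ^ m ∣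
        PowerSeries.rescale (a i) g - PowerSeries.rescale (a i) g' := by
      rw [← map_sub, PowerSeries.X_pow_dvd_iff]
      intro j hj
      rw [PowerSeries.coeff_rescale, PowerSeries.X_pow_dvd_iff.1 h j hj, mul_zero]
    exact dvd_mul_sub_mul h1 ih

/-- With at least two factors, every term of the telescoped difference contains a further factor
divisible by `X`; this gains the extra power that uniqueness needs. -/
theorem X_pow_succ_dvd_prod_rescale_sub {R : Type*} [CommRing R] {g g' : R⟦X⟧} {m : ℕ}
    (hg : PowerSeries.constantCoeff g = 0) (hg' : PowerSeries.constantCoeff g' = 0)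
    (h : (PowerSeries.X : R⟦X⟧) ^ m ∣ g - g') (a : ℕ → R) (n : ℕ) :
    (PowerSeries.X : R⟦X⟧) ^ (m + 1) ∣
      ∏ k ∈ Finset.range (n + 2), PowerSeries.rescale (a k) g -
        ∏ k ∈ Finset.range (n + 2), PowerSeries.rescale (a k) g' := by
  rw [Finset.prod_range_succ, Finset.prod_range_succ _ (n + 1)]
  have h1 := X_pow_dvd_prod_rescale_sub h a (Finset.range (n + 1))
  have h2 := X_pow_dvd_prod_rescale_sub h a {n + 1}
  rw [Finset.prod_singleton, Finset.prod_singleton] at h2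
  have h3 : (PowerSeries.X : R⟦X⟧) ∣ ∏ k ∈ Finset.range (n + 1), PowerSeries.rescale (a k) g' :=
    (dvd_pow_self _ n.succ_ne_zero).trans (X_pow_dvd_prod_rescale hg' a (n + 1))
  set A := ∏ k ∈ Finset.range (n + 1), PowerSeries.rescale (a k) g
  set A' := ∏ k ∈ Finset.range (n + 1), PowerSeries.rescale (a k) g'
  rw [show A * PowerSeries.rescale (a (n + 1)) g - A' * PowerSeries.rescale (a (n + 1)) g' =
    (A - A') * PowerSeries.rescale (a (n + 1)) g + (PowerSeries.rescale (a (n + 1)) g -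
      PowerSeries.rescale (a (n + 1)) g') * A' by ring, pow_succ]
  exact dvd_add (mul_dvd_mul h1 (X_dvd_rescale hg _)) (mul_dvd_mul h2 h3)

end Inversion

/-- In the coefficient of `z^j` only the term `n = 1` involves `g_j`, through `f₁ g_j`; the others
depend on earlier coefficients. -/
theorem IsQRightInverse.unique {q : ℝ} {f g g' : ℝ⟦X⟧} (hf1 : PowerSeries.coeff 1 f ≠ 0)
    (hg : IsQRightInverse q f g) (hg' : IsQRightInverse q f g') : g = g' := by
  suffices h : ∀ m, (PowerSeries.X : ℝ⟦X⟧) ^ m ∣ g - g' by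
    ext m
    have := PowerSeries.X_pow_dvd_iff.1 (h (m + 1)) m (Nat.lt_succ_self m)
    rwa [map_sub, sub_eq_zero] at this
  intro m
  induction m with
  | zero => simp
  | succ m ih =>
    rw [PowerSeries.X_pow_dvd_iff]
    intro j hj
    rcases (Nat.lt_succ_iff.1 hj).lt_or_eq with hj | rfl
    · exact PowerSeries.X_pow_dvd_iff.1 ih j hj
    rcases j.eq_zero_or_pos with rfl | hpos
    · simp [hg.1, hg'.1]
    have e := (hg.2 j).trans (hg'.2 j).symm
    obtain ⟨i, rfl⟩ : ∃ i, j = i + 1 := ⟨j - 1, by omega⟩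
    rw [← Finset.add_sum_Ioc_eq_sum_Icc (by omega), ← Finset.add_sum_Ioc_eq_sum_Icc (by omega)] at e
    have e2 : ∀ n ∈ Finset.Ioc 1 (i + 1),
        PowerSeries.coeff n f * PowerSeries.coeff (i + 1)
          (∏ k ∈ Finset.range n, PowerSeries.rescale ((q ^ k)⁻¹) g) =
        PowerSeries.coeff n f * PowerSeries.coeff (i + 1)
          (∏ k ∈ Finset.range n, PowerSeries.rescale ((q ^ k)⁻¹) g') := by
      intro n hn
      obtain ⟨l, rfl⟩ : ∃ l, n = l + 2 := ⟨n - 2, by have := Finset.mem_Ioc.1 hn; omega⟩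
      have := PowerSeries.X_pow_dvd_iff.1 (X_pow_succ_dvd_prod_rescale_sub hg.1 hg'.1 ih
        (fun k => (q ^ k)⁻¹) l) (i + 1) (Nat.lt_succ_self _)
      rw [map_sub, sub_eq_zero] at this
      rw [this]
    rw [Finset.sum_congr rfl e2] at e
    have e3 := mul_left_cancel₀ hf1 (add_right_cancel e)
    simp only [Finset.prod_range_one, pow_zero, inv_one, PowerSeries.rescale_one,
      RingHom.id_apply] at e3
    rw [map_sub, e3, sub_self]

end

/-! ### The sequences `bₙ` and `cₙ`, and the recursions that link them. -/

noncomputable section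

/-- The coefficients `bₙ` of the `q`-Lagrange inversion:
`∑ₖ bₖ zᵏ (1 - φ(z)) ⋯ (1 - φ(q^{k-1}z)) = z`. -/
def qInv {R : Type*} [CommRing R] (q : R) (φ : R⟦X⟧) : ℕ → R :=
  WellFounded.fix Nat.lt_wfRel.wf fun m b => (if m = 1 then 1 else 0) -
    ∑ k : Fin m, b k k.2 * PowerSeries.coeff (m - k) (qPow q (1 - φ) k)

/-- The coefficients `cₙ` of the power series `H` with `H(0) = 1` and
`H(w) (1 - ψ(w)) = H(q w)`. -/
def qRenewal {R : Type*} [CommRing R] (q : R) (ψ : R⟦X⟧) : ℕ → R :=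
  WellFounded.fix Nat.lt_wfRel.wf fun m c => if m = 0 then 1 else
    Ring.inverse (1 - q ^ m) * ∑ k : Fin m, PowerSeries.coeff (m - k) ψ * c k k.2

section

variable {R : Type*} [CommRing R]

theorem qInv_eq (q : R) (φ : R⟦X⟧) (m : ℕ) : qInv q φ m = (if m = 1 then 1 else 0) -
    ∑ k ∈ Finset.range m, qInv q φ k * PowerSeries.coeff (m - k) (qPow q (1 - φ) k) := by
  rw [Finset.sum_range (fun k => qInv q φ k * PowerSeries.coeff (m - k) (qPow q (1 - φ) k)), qInv,
    WellFounded.fix_eq]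

theorem qInv_zero (q : R) (φ : R⟦X⟧) : qInv q φ 0 = 0 := by
  rw [qInv_eq]; simp

theorem qRenewal_zero (q : R) (ψ : R⟦X⟧) : qRenewal q ψ 0 = 1 := by
  rw [qRenewal, WellFounded.fix_eq]; simp

theorem qRenewal_eq (q : R) (ψ : R⟦X⟧) {m : ℕ} (hm : m ≠ 0) :
    qRenewal q ψ m = Ring.inverse (1 - q ^ m) *
      ∑ k ∈ Finset.range m, PowerSeries.coeff (m - k) ψ * qRenewal q ψ k := by
  rw [Finset.sum_range (fun k => PowerSeries.coeff (m - k) ψ * qRenewal q ψ k), qRenewal,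
    WellFounded.fix_eq, if_neg hm]

theorem constantCoeff_qPow_one_sub (q : R) {φ : R⟦X⟧} (hφ : PowerSeries.constantCoeff φ = 0)
    (k : ℕ) : PowerSeries.coeff 0 (qPow q (1 - φ) k) = 1 := by
  rw [PowerSeries.coeff_zero_eq_constantCoeff_apply, qPow, map_prod]
  refine Finset.prod_eq_one fun i _ => ?_
  rw [← PowerSeries.coeff_zero_eq_constantCoeff_apply, PowerSeries.coeff_rescale, pow_zero, one_mul,
    PowerSeries.coeff_zero_eq_constantCoeff_apply, map_sub, hφ, map_one, sub_zero]

theorem sum_qInv (q : R) {φ : R⟦X⟧} (hφ : PowerSeries.constantCoeff φ = 0) (m : ℕ) :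
    ∑ k ∈ Finset.range (m + 1), qInv q φ k * PowerSeries.coeff (m - k) (qPow q (1 - φ) k) =
      if m = 1 then 1 else 0 := by
  rw [Finset.sum_range_succ, Nat.sub_self, constantCoeff_qPow_one_sub q hφ, mul_one,
    qInv_eq q φ m]
  ring

theorem qPow_map {S : Type*} [CommRing S] (π : R →+* S) (q : R) (f : R⟦X⟧) (n : ℕ) :
    PowerSeries.map π (qPow q f n) = qPow (π q) (PowerSeries.map π f) n := by
  rw [qPow, map_prod]
  refine Finset.prod_congr rfl fun k _ => ?_
  ext m
  simp [PowerSeries.coeff_rescale]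

/-- The recursion uses ring operations only. Hence one polynomial in `q` gives both the values at
real `q` and the coefficients. -/
theorem map_qInv {S : Type*} [CommRing S] (π : R →+* S) (q : R) (φ : R⟦X⟧) (m : ℕ) :
    π (qInv q φ m) = qInv (π q) (PowerSeries.map π φ) m := by
  induction m using Nat.strong_induction_on with
  | _ m ih =>
    rw [qInv_eq, qInv_eq (π q), map_sub, map_sum]
    congr 1
    · split_ifs <;> simp
    · refine Finset.sum_congr rfl fun k hk => ?_
      rw [map_mul, ih k (Finset.mem_range.1 hk), ← PowerSeries.coeff_map, qPow_map, map_sub, map_one]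

/-- Substitution of `ζz` for `z` in the defining identity; its right side `ζz` accounts for the
factor `ζ`. -/
theorem pow_mul_qInv (q ζ : R) (φ : R⟦X⟧) (m : ℕ) :
    ζ ^ m * qInv q φ m = ζ * qInv q (PowerSeries.rescale ζ φ) m := by
  induction m using Nat.strong_induction_on with
  | _ m ih =>
    rw [qInv_eq, qInv_eq q (PowerSeries.rescale ζ φ), mul_sub, mul_sub, Finset.mul_sum,
      Finset.mul_sum]
    congr 1
    · split_ifs with h <;> simp [h]
    · refine Finset.sum_congr rfl fun k hk => ?_
      have hk' := Finset.mem_range.1 hk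
      have h1 : qPow q (1 - PowerSeries.rescale ζ φ) k =
          PowerSeries.rescale ζ (qPow q (1 - φ) k) := by
        rw [qPow, qPow, map_prod]
        refine Finset.prod_congr rfl fun i _ => ?_
        rw [PowerSeries.rescale_rescale, mul_comm, ← PowerSeries.rescale_rescale]
        simp only [map_sub, map_one]
      rw [h1, PowerSeries.coeff_rescale, ← mul_assoc ζ, ← ih k hk', show m = k + (m - k) by omega,
        pow_add, Nat.add_sub_cancel_left]
      ring

/-- The factors `z, qz, …, q^(n-1)z` multiply to `q^(n choose 2) zⁿ`, which is the origin of the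
weight on `gₙ`. -/
theorem qComp_X_mul_one_sub {q : R} {φ : R⟦X⟧} (hφ : PowerSeries.constantCoeff φ = 0) (g : R⟦X⟧)
    (hg : ∀ n, q ^ n.choose 2 * PowerSeries.coeff n g = qInv q φ n) :
    qComp q (PowerSeries.X * (1 - φ)) g = PowerSeries.X := by
  have h1 : ∀ n, qPow q (PowerSeries.X * (1 - φ)) n =
      PowerSeries.C (q ^ n.choose 2) * (PowerSeries.X ^ n * qPow q (1 - φ) n) := by
    intro n
    induction n with
    | zero => simp [qPow]
    | succ n ih =>
      rw [qPow_succ, ih, qPow_succ, map_mul, rescale_C', map_mul,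
        (PowerSeries.rescale q).map_pow, PowerSeries.rescale_X,
        Nat.choose_succ_succ' n 1, Nat.choose_one_right, pow_add, map_mul, mul_pow]
      simp only [map_pow]
      ring
  ext m
  rw [qComp, PowerSeries.coeff_mk, PowerSeries.coeff_X, ← sum_qInv q hφ m]
  refine Finset.sum_congr rfl fun n hn => ?_
  rw [h1, PowerSeries.coeff_C_mul, ← hg, PowerSeries.coeff_X_pow_mul',
    if_pos (Nat.lt_succ_iff.1 (Finset.mem_range.1 hn))]
  ring

theorem qRenewal_mul_one_sub {q : R} (hq : ∀ m, m ≠ 0 → IsUnit (1 - q ^ m)) {ψ : R⟦X⟧}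
    (hψ : PowerSeries.constantCoeff ψ = 0) :
    PowerSeries.mk (qRenewal q ψ) * (1 - ψ) =
      PowerSeries.rescale q (PowerSeries.mk (qRenewal q ψ)) := by
  ext m
  rw [mul_sub, mul_one, map_sub, PowerSeries.coeff_rescale, mul_comm, PowerSeries.coeff_mul,
    PowerSeries.coeff_mk, ← Finset.Nat.sum_antidiagonal_swap,
    Finset.Nat.sum_antidiagonal_eq_sum_range_succ_mk, Finset.sum_range_succ]
  simp only [Prod.swap, PowerSeries.coeff_mk, Nat.sub_self,
    PowerSeries.coeff_zero_eq_constantCoeff_apply, hψ, zero_mul, add_zero]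
  rcases eq_or_ne m 0 with rfl | hm
  · simp
  · have := qRenewal_eq q ψ hm
    have h2 : (1 - q ^ m) * qRenewal q ψ m =
        ∑ k ∈ Finset.range m, PowerSeries.coeff (m - k) ψ * qRenewal q ψ k := by
      rw [this, ← mul_assoc, Ring.mul_inverse_cancel _ (hq m hm), one_mul]
    rw [← h2]; ring

theorem qRenewal_mul_qPow {q : R} (hq : ∀ m, m ≠ 0 → IsUnit (1 - q ^ m)) {ψ : R⟦X⟧}
    (hψ : PowerSeries.constantCoeff ψ = 0) (k : ℕ) :
    PowerSeries.mk (qRenewal q ψ) * qPow q (1 - ψ) k =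
      PowerSeries.rescale (q ^ k) (PowerSeries.mk (qRenewal q ψ)) := by
  induction k with
  | zero => simp [qPow]
  | succ k ih =>
    rw [qPow_succ, ← mul_assoc, qRenewal_mul_one_sub hq hψ, ← map_mul, ih, rescale_rescale_pow]

/-- The relation between the coefficients of the `q`-Lagrange inversion and those of
`H = 1 / ∏ᵢ (1 - ψ(qⁱ w))`. -/
theorem sum_qInv_mul_qRenewal {q : R} (hq : ∀ m, m ≠ 0 → IsUnit (1 - q ^ m)) {ψ : R⟦X⟧}
    (hψ : PowerSeries.constantCoeff ψ = 0) (n : ℕ) :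
    ∑ k ∈ Finset.range (n + 2), qInv q ψ k * (q ^ (k * (n + 1 - k)) * qRenewal q ψ (n + 1 - k)) =
      qRenewal q ψ n := by
  set H := PowerSeries.mk (qRenewal q ψ) with hH
  set S : R⟦X⟧ := ∑ k ∈ Finset.range (n + 2),
    PowerSeries.C (qInv q ψ k) * (PowerSeries.X ^ k * qPow q (1 - ψ) k) with hS
  -- The truncated sum `S` agrees with `z` up to order `n + 1`, so `H S` and `z H` have the same
  -- coefficient of `z^(n+1)`.
  have h1 : (PowerSeries.X : R⟦X⟧) ^ (n + 2) ∣ S - PowerSeries.X := by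
    rw [PowerSeries.X_pow_dvd_iff]
    intro m hm
    rw [map_sub, PowerSeries.coeff_X, ← sum_qInv q hψ m, hS, map_sum, sub_eq_zero]
    symm
    simp only [PowerSeries.coeff_C_mul, PowerSeries.coeff_X_pow_mul']
    refine Eq.trans ?_ (Finset.sum_subset (s₁ := Finset.range (m + 1)) ?_ ?_)
    · refine Finset.sum_congr rfl fun k hk => ?_
      rw [if_pos (Nat.lt_succ_iff.1 (Finset.mem_range.1 hk))]
    · intro x; simp; omega
    · intro k _ hk
      rw [if_neg (by simpa using hk), mul_zero]
  have h2 := PowerSeries.X_pow_dvd_iff.1 (h1.mul_left H) (n + 1) (by omega)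
  rw [mul_sub, map_sub, sub_eq_zero, PowerSeries.coeff_succ_mul_X, hS, Finset.mul_sum, map_sum,
    hH, PowerSeries.coeff_mk, ← hH] at h2
  rw [← h2]
  refine Finset.sum_congr rfl fun k hk => ?_
  rw [show H * (PowerSeries.C (qInv q ψ k) * (PowerSeries.X ^ k * qPow q (1 - ψ) k)) =
    PowerSeries.C (qInv q ψ k) * (PowerSeries.X ^ k * (H * qPow q (1 - ψ) k)) by ring,
    qRenewal_mul_qPow hq hψ, PowerSeries.coeff_C_mul, PowerSeries.coeff_X_pow_mul',
    if_pos (Nat.lt_succ_iff.1 (Finset.mem_range.1 hk)), PowerSeries.coeff_rescale,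
    PowerSeries.coeff_mk, ← pow_mul]

/-- The top term of the preceding relation is isolated. Each remaining one carries `q^((k+1)(n-k))`,
with exponent at least `n`. -/
theorem qInv_succ {q : R} (hq : ∀ m, m ≠ 0 → IsUnit (1 - q ^ m)) {ψ : R⟦X⟧}
    (hψ : PowerSeries.constantCoeff ψ = 0) (n : ℕ) :
    qInv q ψ (n + 1) = qRenewal q ψ n - ∑ k ∈ Finset.range n,
      qInv q ψ (k + 1) * (q ^ ((k + 1) * (n - k)) * qRenewal q ψ (n - k)) := by
  rw [← sum_qInv_mul_qRenewal hq hψ n, Finset.sum_range_succ, Finset.sum_range_succ', qInv_zero]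
  simp [qRenewal_zero]

/-- Coefficients of `H(w) = H(qw) W(w)`, where `W = 1/(1 - ψ)`. -/
theorem qRenewal_eq_sum {q : R} (hq : ∀ m, m ≠ 0 → IsUnit (1 - q ^ m)) {ψ W : R⟦X⟧}
    (hψ : PowerSeries.constantCoeff ψ = 0) (hW : W * (1 - ψ) = 1) (n : ℕ) :
    qRenewal q ψ n = ∑ i ∈ Finset.range (n + 1),
      PowerSeries.coeff (n - i) W * (q ^ i * qRenewal q ψ i) := by
  have h : PowerSeries.mk (qRenewal q ψ) =
      PowerSeries.rescale q (PowerSeries.mk (qRenewal q ψ)) * W := by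
    rw [← qRenewal_mul_one_sub hq hψ, mul_assoc, mul_comm _ W, hW, mul_one]
  have h2 := congrArg (PowerSeries.coeff n) h
  rw [PowerSeries.coeff_mk, PowerSeries.coeff_mul,
    Finset.Nat.sum_antidiagonal_eq_sum_range_succ_mk] at h2
  rw [h2]
  refine Finset.sum_congr rfl fun i _ => ?_
  simp only [PowerSeries.coeff_rescale, PowerSeries.coeff_mk]
  ring

end

end

/-! ### Regularly varying sequences: local bounds and Potter's bounds. -/

section RegularVariation

open MeasureTheory

variable {u : ℕ → ℝ} {α : ℝ}

theorem IsRegularlyVaryingSeq.tendsto_floor (h : IsRegularlyVaryingSeq u α) {c : ℝ} (hc : 0 < c) :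
    Tendsto (fun n : ℕ => u ⌊c * (n : ℝ)⌋₊ / u n) atTop (𝓝 (c ^ α)) := by
  have := (h c hc).comp tendsto_natCast_atTop_atTop
  refine this.congr fun n => ?_
  simp

theorem IsRegularlyVaryingSeq.eventually_ne_zero (h : IsRegularlyVaryingSeq u α) :
    ∀ᶠ n in atTop, u n ≠ 0 := by
  have := h.tendsto_floor one_pos
  rw [Real.one_rpow] at this
  filter_upwards [this.eventually_ne one_ne_zero] with n hn h0
  exact hn (by rw [h0, div_zero])

theorem IsRegularlyVaryingSeq.eventually_pos (h : IsRegularlyVaryingSeq u α) (hu : ∀ n, 0 ≤ u n) :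
    ∀ᶠ n in atTop, 0 < u n := by
  filter_upwards [h.eventually_ne_zero] with n hn using (hu n).lt_of_ne' hn

/-- Consecutive terms of a regularly varying sequence are equivalent. -/
theorem IsRegularlyVaryingSeq.tendsto_succ_div (h : IsRegularlyVaryingSeq u α) :
    Tendsto (fun n : ℕ => u (n + 1) / u n) atTop (𝓝 1) := by
  have hs : (0 : ℝ) < √2 := Real.sqrt_pos.2 two_pos
  have hs1 : (1 : ℝ) < √2 := Real.lt_sqrt_of_sq_lt (by norm_num)
  -- the points `t₁ < t₂` have the same integer part, while `⌊√2 t₁⌋ = m` and `⌊√2 t₂⌋ = m + 1`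
  let t₂ : ℕ → ℝ := fun m => ((m + 1 : ℕ) : ℝ) / √2
  let t₁ : ℕ → ℝ := fun m => max (⌊t₂ m⌋₊ : ℝ) ((m : ℝ) / √2)
  have ht₂ : Tendsto t₂ atTop atTop :=
    (tendsto_natCast_atTop_atTop.comp (tendsto_add_atTop_nat 1)).atTop_div_const hs
  have ht₁ : Tendsto t₁ atTop atTop :=
    tendsto_atTop_mono (fun m => le_max_right _ _) (tendsto_natCast_atTop_atTop.atTop_div_const hs)
  have hpos : ∀ m, 0 ≤ t₂ m := fun m => by positivity
  -- Irrationality of `√2` keeps `t₂` off the integers, which leaves room for `t₁ < t₂` in the same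
  -- unit interval.
  have hlt : ∀ m, (⌊t₂ m⌋₊ : ℝ) < t₂ m := by
    intro m
    refine (Nat.floor_le (hpos m)).lt_of_ne fun heq => ?_
    have h1 : Irrational (((m + 1 : ℕ) : ℝ) / √2) :=
      irrational_sqrt_two.natCast_div (Nat.succ_ne_zero m)
    exact h1.ne_nat _ heq.symm
  have hlt' : ∀ m, t₁ m < t₂ m := fun m =>
    max_lt (hlt m) (div_lt_div_of_pos_right (by push_cast; linarith) hs)
  have hfl : ∀ m, ⌊t₁ m⌋₊ = ⌊t₂ m⌋₊ := fun m =>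
    le_antisymm (Nat.floor_mono (hlt' m).le) (Nat.le_floor (le_max_left _ _))
  have hf2 : ∀ m, ⌊√2 * t₂ m⌋₊ = m + 1 := by
    intro m
    rw [show √2 * t₂ m = ((m + 1 : ℕ) : ℝ) from mul_div_cancel₀ _ hs.ne', Nat.floor_natCast]
  have hf1 : ∀ m, ⌊√2 * t₁ m⌋₊ = m := by
    intro m
    rw [Nat.floor_eq_iff (mul_nonneg hs.le ((Nat.cast_nonneg _).trans (le_max_left _ _)))]
    constructor
    · rw [← div_le_iff₀' hs]; exact le_max_right _ _
    · rw [← lt_div_iff₀' hs]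
      exact_mod_cast hlt' m
  have e1 := (h √2 hs).comp ht₁
  have e2 := (h √2 hs).comp ht₂
  have e3 := e2.div e1 (Real.rpow_pos_of_pos hs α).ne'
  rw [div_self (Real.rpow_pos_of_pos hs α).ne'] at e3
  refine e3.congr' ?_
  have hne : ∀ᶠ m in atTop, u ⌊t₂ m⌋₊ ≠ 0 :=
    (tendsto_nat_floor_atTop.comp ht₂).eventually h.eventually_ne_zero
  filter_upwards [hne] with m hm
  simp only [Function.comp, Pi.div_apply, hf1, hf2, hfl]
  exact div_div_div_cancel_right₀ hm _ _

/-- Local boundedness of a regularly varying sequence of index in `[-1, 0]`. -/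
theorem IsRegularlyVaryingSeq.local_bound (h : IsRegularlyVaryingSeq u α) (hu : ∀ n, 0 ≤ u n)
    (hα : -1 ≤ α) (hα' : α ≤ 0) :
    ∃ N : ℕ, ∀ n m : ℕ, N ≤ n → n ≤ m → m ≤ 2 * n → u m ≤ 16 * u n ∧ u n ≤ 16 * u m := by
  let F : ℕ → ℝ → ℝ := fun n c => u ⌊c * (n : ℝ)⌋₊ / u n
  have hFm : ∀ n, StronglyMeasurable (F n) := fun n => by
    refine Measurable.stronglyMeasurable ?_
    exact (((measurable_from_nat (f := u)).comp (Nat.measurable_floor.comp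
      (measurable_id.mul_const (n : ℝ)))).div_const _)
  have hgm : StronglyMeasurable (fun c : ℝ => c ^ α) :=
    (measurable_id.pow_const α).stronglyMeasurable
  -- Egorov's theorem on `[1, 4]`: the convergence is uniform outside a set `t` of measure at most
  -- `1/2`.
  obtain ⟨t, ht, htm, htv, hunif⟩ := tendstoUniformlyOn_of_ae_tendsto (μ := volume)
    (s := Set.Icc (1 : ℝ) 4) hFm hgm measurableSet_Icc (by simp)
    (Eventually.of_forall fun c hc => h.tendsto_floor (lt_of_lt_of_le one_pos hc.1))
    (ε := 1 / 2) (by norm_num)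
  have hev := Metric.tendstoUniformlyOn_iff.1 hunif (1 / 8) (by norm_num)
  obtain ⟨N₁, hN₁⟩ := eventually_atTop.1 hev
  obtain ⟨N₂, hN₂⟩ := eventually_atTop.1 (h.eventually_pos hu)
  -- On `[1, 4]` the limit `c ^ α` lies in `[1/4, 1]`, so an error of `1/8` keeps the ratio between
  -- `1/8` and `9/8`.
  have key : ∀ n, max N₁ (max N₂ 1) ≤ n → ∀ c ∈ Set.Icc (1 : ℝ) 4 \ t,
      u n ≤ 8 * u ⌊c * (n : ℝ)⌋₊ ∧ u ⌊c * (n : ℝ)⌋₊ ≤ 2 * u n := by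
    intro n hn c hc
    have hn1 := hN₁ n (by omega) c hc
    have hn2 := hN₂ n (by omega)
    have hc0 : (0 : ℝ) < c := lt_of_lt_of_le one_pos hc.1.1
    have h1 : c ^ α ≤ 1 := Real.rpow_le_one_of_one_le_of_nonpos hc.1.1 hα'
    have h2 : 1 / 4 ≤ c ^ α := by
      calc (1 / 4 : ℝ) ≤ 1 / c := one_div_le_one_div_of_le hc0 hc.1.2
        _ = c ^ (-1 : ℝ) := by rw [Real.rpow_neg_one, one_div]
        _ ≤ c ^ α := Real.rpow_le_rpow_of_exponent_le hc.1.1 hα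
    rw [Real.dist_eq, abs_lt] at hn1
    simp only [F] at hn1
    have h3 : u ⌊c * (n : ℝ)⌋₊ = u ⌊c * (n : ℝ)⌋₊ / u n * u n := (div_mul_cancel₀ _ hn2.ne').symm
    set r := u ⌊c * (n : ℝ)⌋₊ / u n
    rw [h3]
    constructor
    · nlinarith [hn1.2]
    · nlinarith [hn1.1]
  refine ⟨max N₁ (max N₂ 1), fun n m hn hnm hm => ?_⟩
  have hn0 : (0 : ℝ) < n := by exact_mod_cast (by omega : 0 < n)
  have hm0 : (0 : ℝ) < m := by exact_mod_cast (by omega : 0 < m)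
  set l : ℝ := m / n with hl
  have hl1 : 1 ≤ l := by rw [hl, le_div_iff₀ hn0, one_mul]; exact_mod_cast hnm
  have hl2 : l ≤ 2 := by rw [hl, div_le_iff₀ hn0]; exact_mod_cast hm
  -- a point `c ∈ [2, 4]` outside the exceptional set and outside its dilation by `l`
  have hex : ∃ c ∈ Set.Icc (2 : ℝ) 4, c ∉ t ∧ l⁻¹ * c ∉ t := by
    by_contra! hcon
    have hsub : Set.Icc (2 : ℝ) 4 ⊆ t ∪ (fun c => l⁻¹ * c) ⁻¹' t := fun c hc => by
      by_cases hct : c ∈ t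
      · exact Or.inl hct
      · exact Or.inr (hcon c hc hct)
    -- The two exceptional sets have total measure at most `1/2 + l/2 ≤ 3/2`, less than the length 2
    -- of `[2, 4]`.
    have hv := (measure_mono hsub).trans (measure_union_le (μ := volume) _ _)
    rw [Real.volume_Icc, Real.volume_preimage_mul_left (inv_ne_zero (by positivity)), inv_inv,
      abs_of_pos (by positivity)] at hv
    have h5 : ENNReal.ofReal (4 - 2) ≤ ENNReal.ofReal (1 / 2) +
        ENNReal.ofReal l * ENNReal.ofReal (1 / 2) :=
      hv.trans (add_le_add htv (mul_le_mul_right htv _))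
    rw [← ENNReal.ofReal_mul (by positivity), ← ENNReal.ofReal_add (by norm_num) (by positivity),
      ENNReal.ofReal_le_ofReal_iff (by positivity)] at h5
    linarith
  obtain ⟨c, hc, hct, hct'⟩ := hex
  have hl0 : 0 < l := by linarith
  have hc1 : l⁻¹ * c ∈ Set.Icc (1 : ℝ) 4 := by
    rw [inv_mul_eq_div]
    constructor
    · rw [le_div_iff₀ hl0]; linarith [hc.1]
    · rw [div_le_iff₀ hl0]; linarith [hc.2]
  have k1 := key n hn c ⟨⟨by linarith [hc.1], hc.2⟩, hct⟩
  have k2 := key m (by omega) (l⁻¹ * c) ⟨hc1, hct'⟩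
  -- Both `u n` and `u m` are thus compared with the same term `u ⌊c n⌋`, and `8 * 2 = 16`.
  have he : l⁻¹ * c * (m : ℝ) = c * n := by
    rw [hl]; field_simp
  rw [he] at k2
  constructor
  · linarith [k1.2, k2.1]
  · linarith [k2.2, k1.1]

/-- The ratios `u (2v) / u v` and `u (2v+1) / u v` tend to `2 ^ α`, strictly between `2 ^ β` and 2.
This is the dyadic step iterated in Potter's bounds. -/
theorem IsRegularlyVaryingSeq.doubling (h : IsRegularlyVaryingSeq u α) (hu : ∀ n, 0 ≤ u n)
    (hα' : α ≤ 0) {β : ℝ} (hβ : β < α) :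
    ∃ N : ℕ, ∀ v n : ℕ, N ≤ v → n / 2 = v → u v ≤ 2 ^ (-β) * u n ∧ u n ≤ 2 * u v := by
  have hlim := h.tendsto_floor two_pos
  have hodd : Tendsto (fun n : ℕ => u (2 * n + 1) / u n) atTop (𝓝 (2 ^ α)) := by
    have h1 := h.tendsto_succ_div.comp (tendsto_id.const_mul_atTop' (two_pos : 0 < 2))
    have h2 := h1.mul hlim
    rw [one_mul] at h2
    refine h2.congr' ?_
    filter_upwards [(tendsto_id.const_mul_atTop' (two_pos : 0 < 2)).eventually h.eventually_ne_zero]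
      with n hn
    have : ⌊(2 : ℝ) * (n : ℝ)⌋₊ = 2 * n := by exact_mod_cast Nat.floor_natCast (R := ℝ) (2 * n)
    simp only [Function.comp, this, id] at hn ⊢
    exact div_mul_div_cancel₀ hn
  have heven : Tendsto (fun n : ℕ => u (2 * n) / u n) atTop (𝓝 (2 ^ α)) :=
    hlim.congr fun n => by
      have : ⌊(2 : ℝ) * (n : ℝ)⌋₊ = 2 * n := by exact_mod_cast Nat.floor_natCast (R := ℝ) (2 * n)
      rw [this]
  have hlow : (2 : ℝ) ^ β < 2 ^ α := Real.rpow_lt_rpow_of_exponent_lt one_lt_two hβ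
  have hup : (2 : ℝ) ^ α < 2 :=
    lt_of_le_of_lt (Real.rpow_le_one_of_one_le_of_nonpos one_le_two hα') one_lt_two
  have hev : ∀ᶠ v in atTop, ((2 : ℝ) ^ β < u (2 * v) / u v ∧ u (2 * v) / u v < 2) ∧
      ((2 : ℝ) ^ β < u (2 * v + 1) / u v ∧ u (2 * v + 1) / u v < 2) ∧ 0 < u v :=
    ((heven.eventually_const_lt hlow).and (heven.eventually_lt_const hup)).and
      (((hodd.eventually_const_lt hlow).and (hodd.eventually_lt_const hup)).and
        (h.eventually_pos hu))
  obtain ⟨N, hN⟩ := eventually_atTop.1 hev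
  refine ⟨N, fun v n hv hn => ?_⟩
  obtain ⟨⟨a1, a2⟩, ⟨b1, b2⟩, hpos⟩ := hN v hv
  rw [lt_div_iff₀ hpos] at a1 b1
  rw [div_lt_iff₀ hpos] at a2 b2
  rw [Real.rpow_neg two_pos.le, inv_mul_eq_div, le_div_iff₀ (Real.rpow_pos_of_pos two_pos _)]
  rcases Nat.mod_two_eq_zero_or_one n with h0 | h0
  · obtain rfl : n = 2 * v := by omega
    constructor <;> linarith
  · obtain rfl : n = 2 * v + 1 := by omega
    constructor <;> linarith

/-- Potter's bound below the diagonal. -/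
theorem IsRegularlyVaryingSeq.potter_lower (h : IsRegularlyVaryingSeq u α) (hu : ∀ n, 0 ≤ u n)
    (hα : -1 ≤ α) (hα' : α ≤ 0) {β : ℝ} (hβ : β < α) (hβ' : -1 ≤ β) :
    ∃ (C : ℝ) (N : ℕ), 0 < C ∧ ∀ n k : ℕ, N ≤ n → k ≤ n →
      ((k + 1 : ℕ) : ℝ) ^ (-β) * u k ≤ C * ((n : ℝ) ^ (-β) * u n) := by
  obtain ⟨N₁, hN₁⟩ := h.local_bound hu hα hα'
  obtain ⟨N₂, hN₂⟩ := h.doubling hu hα' hβ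
  obtain ⟨N₃, hN₃⟩ := eventually_atTop.1 (h.eventually_pos hu)
  set N := max (max N₁ N₂) (max N₃ 1) with hN
  have hβ0 : 0 ≤ -β := by linarith
  set s := Finset.range (2 * N + 1) ×ˢ Finset.range (2 * N + 1)
  -- A bound for the finitely many pairs with `n / 2 < N`, where the halving of `n` stops.
  set C₀ : ℝ := ∑ p ∈ s, ((p.2 + 1 : ℕ) : ℝ) ^ (-β) * u p.2 / ((p.1 : ℝ) ^ (-β) * u p.1) with hC₀
  have hnn : ∀ p ∈ s, 0 ≤ ((p.2 + 1 : ℕ) : ℝ) ^ (-β) * u p.2 / ((p.1 : ℝ) ^ (-β) * u p.1) :=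
    fun p _ => div_nonneg (mul_nonneg (by positivity) (hu _)) (mul_nonneg (by positivity) (hu _))
  have hC₀nn : 0 ≤ C₀ := Finset.sum_nonneg hnn
  refine ⟨C₀ + 32, N, by linarith, fun n => ?_⟩
  induction n using Nat.strong_induction_on with
  | _ n ih =>
    intro k hn hk
    have hn0 : 0 < n := by omega
    have hX : 0 ≤ (n : ℝ) ^ (-β) * u n := mul_nonneg (by positivity) (hu _)
    by_cases hv : N ≤ n / 2
    · by_cases hkv : k ≤ n / 2
      -- The weight `n ^ (-β)` absorbs the factor `2 ^ (-β)` of the doubling step, so the constant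
      -- does not grow along the induction.
      · refine (ih (n / 2) (by omega) k hv hkv).trans ?_
        refine mul_le_mul_of_nonneg_left ?_ (by linarith)
        have hd := (hN₂ (n / 2) n (by omega) rfl).1
        calc ((n / 2 : ℕ) : ℝ) ^ (-β) * u (n / 2)
            ≤ ((n / 2 : ℕ) : ℝ) ^ (-β) * (2 ^ (-β) * u n) :=
              mul_le_mul_of_nonneg_left hd (by positivity)
          _ = (((n / 2 : ℕ) : ℝ) * 2) ^ (-β) * u n := by
              rw [Real.mul_rpow (by positivity) (by positivity)]; ring
          _ ≤ (n : ℝ) ^ (-β) * u n := by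
              refine mul_le_mul_of_nonneg_right ?_ (hu n)
              refine Real.rpow_le_rpow (by positivity) ?_ hβ0
              exact_mod_cast (by omega : n / 2 * 2 ≤ n)
      · have hb : u k ≤ 16 * u n := (hN₁ k n (by omega) hk (by omega)).2
        have h2 : ((k + 1 : ℕ) : ℝ) ^ (-β) ≤ 2 * (n : ℝ) ^ (-β) := by
          calc ((k + 1 : ℕ) : ℝ) ^ (-β) ≤ (2 * (n : ℝ)) ^ (-β) := by
                refine Real.rpow_le_rpow (by positivity) ?_ hβ0
                exact_mod_cast (by omega : k + 1 ≤ 2 * n)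
            _ = 2 ^ (-β) * (n : ℝ) ^ (-β) := Real.mul_rpow (by positivity) (by positivity)
            _ ≤ 2 * (n : ℝ) ^ (-β) := by
                refine mul_le_mul_of_nonneg_right ?_ (by positivity)
                calc (2 : ℝ) ^ (-β) ≤ 2 ^ (1 : ℝ) :=
                      Real.rpow_le_rpow_of_exponent_le one_le_two (by linarith)
                  _ = 2 := Real.rpow_one 2
        calc ((k + 1 : ℕ) : ℝ) ^ (-β) * u k ≤ (2 * (n : ℝ) ^ (-β)) * (16 * u n) :=
              mul_le_mul h2 hb (hu _) (by positivity)
          _ = 32 * ((n : ℝ) ^ (-β) * u n) := by ring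
          _ ≤ _ := mul_le_mul_of_nonneg_right (by linarith) hX
    · have hpos : 0 < (n : ℝ) ^ (-β) * u n :=
        mul_pos (Real.rpow_pos_of_pos (by exact_mod_cast hn0) _) (hN₃ n (by omega))
      rw [← div_le_iff₀ hpos]
      have hmem : ((n, k) : ℕ × ℕ) ∈ s := by simp [s]; omega
      have := Finset.single_le_sum hnn hmem
      linarith

/-- Potter's bound above the diagonal. -/
theorem IsRegularlyVaryingSeq.potter_upper (h : IsRegularlyVaryingSeq u α) (hu : ∀ n, 0 ≤ u n)
    (hα : -1 ≤ α) (hα' : α ≤ 0) :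
    ∃ N : ℕ, ∀ n k : ℕ, N ≤ n → n ≤ k → (n : ℝ) * u k ≤ 16 * ((k : ℝ) * u n) := by
  obtain ⟨N₁, hN₁⟩ := h.local_bound hu hα hα'
  obtain ⟨N₂, hN₂⟩ := h.doubling hu hα' (sub_one_lt α)
  refine ⟨max N₁ N₂, fun n k => ?_⟩
  induction k using Nat.strong_induction_on with
  | _ k ih =>
    intro hn hk
    rcases n.eq_zero_or_pos with rfl | hn0
    · rw [Nat.cast_zero, zero_mul]
      exact mul_nonneg (by norm_num) (mul_nonneg (Nat.cast_nonneg _) (hu _))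
    have hnk : (n : ℝ) ≤ k := by exact_mod_cast hk
    by_cases hk2 : k ≤ 2 * n
    · have hb := (hN₁ n k (by omega) hk hk2).1
      nlinarith [mul_le_mul hnk hb (hu k) (by positivity)]
    · have h1 := ih (k / 2) (by omega) hn (by omega)
      have h2 := (hN₂ (k / 2) k (by omega) rfl).2
      have h3 : ((k / 2 : ℕ) : ℝ) * 2 ≤ k := by exact_mod_cast (by omega : k / 2 * 2 ≤ k)
      have h4 : (n : ℝ) * u k ≤ n * (2 * u (k / 2)) := mul_le_mul_of_nonneg_left h2 (by positivity)
      nlinarith [mul_le_mul_of_nonneg_right h3 (hu n)]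

end RegularVariation

/-! ### Karamata's Abelian theorem. -/

section Karamata

open MeasureTheory

theorem tendsto_one_sub_inv_pow_floor {s : ℝ} (hs : 0 < s) :
    Tendsto (fun n : ℕ => (1 - 1 / (n : ℝ)) ^ ⌊s * (n : ℝ)⌋₊) atTop (𝓝 (Real.exp (-s))) := by
  have h1 : Tendsto (fun n : ℕ => (n : ℝ) * Real.log (1 + -1 / (n : ℝ))) atTop (𝓝 (-1)) := by
    refine (Real.tendsto_mul_log_one_add_of_tendsto (g := fun x => -1 / x) ?_).comp
      tendsto_natCast_atTop_atTop
    refine tendsto_const_nhds.congr' ?_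
    filter_upwards [eventually_ne_atTop 0] with x hx
    field_simp
  have h2 : Tendsto (fun n : ℕ => (⌊s * (n : ℝ)⌋₊ : ℝ) / n) atTop (𝓝 s) :=
    (tendsto_nat_floor_mul_div_atTop hs.le).comp tendsto_natCast_atTop_atTop
  have h3 := (Real.continuous_exp.tendsto _).comp (h2.mul h1)
  rw [mul_neg_one] at h3
  refine h3.congr' ?_
  filter_upwards [eventually_gt_atTop 1] with n hn
  have hn1 : (1 : ℝ) < n := by exact_mod_cast hn
  have hpos : 0 < 1 - 1 / (n : ℝ) := by
    rw [sub_pos, div_lt_one (by linarith)]; exact hn1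
  have e : (⌊s * (n : ℝ)⌋₊ : ℝ) / n * (n * Real.log (1 + -1 / (n : ℝ))) =
      ⌊s * (n : ℝ)⌋₊ * Real.log (1 - 1 / (n : ℝ)) := by
    rw [neg_div, ← sub_eq_add_neg]; field_simp
  rw [Function.comp, e, Real.exp_nat_mul, Real.exp_log hpos]

theorem iUnion_Ico_div_nat {n : ℕ} (hn : 0 < n) :
    ⋃ k : ℕ, Set.Ico ((k : ℝ) / n) ((k + 1 : ℝ) / n) = Set.Ici 0 := by
  have hn0 : (0 : ℝ) < n := by exact_mod_cast hn
  ext x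
  simp only [Set.mem_iUnion, Set.mem_Ico, Set.mem_Ici]
  constructor
  · rintro ⟨k, hk, _⟩
    exact le_trans (by positivity) hk
  · intro hx
    refine ⟨⌊x * n⌋₊, ?_, ?_⟩
    · rw [div_le_iff₀ hn0]; exact Nat.floor_le (by positivity)
    · rw [lt_div_iff₀ hn0]; exact Nat.lt_floor_add_one _

theorem floor_mul_of_mem_Ico {n k : ℕ} (hn : 0 < n) {x : ℝ}
    (hx : x ∈ Set.Ico ((k : ℝ) / n) ((k + 1 : ℝ) / n)) : ⌊x * n⌋₊ = k := by
  have hn0 : (0 : ℝ) < n := by exact_mod_cast hn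
  have h1 := (div_le_iff₀ hn0).1 hx.1
  exact (Nat.floor_eq_iff ((Nat.cast_nonneg k).trans h1)).2 ⟨h1, (lt_div_iff₀ hn0).1 hx.2⟩

/-- The integral of a function constant on the intervals `[k/n, (k+1)/n)` is a series. -/
theorem integral_comp_floor_mul {n : ℕ} (hn : 0 < n) (F : ℕ → ℝ)
    (hF : IntegrableOn (fun s : ℝ => F ⌊s * n⌋₊) (Set.Ioi 0)) :
    ∫ s in Set.Ioi (0 : ℝ), F ⌊s * n⌋₊ = (∑' k, F k) / n := by
  have hn0 : (0 : ℝ) < n := by exact_mod_cast hn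
  have hdisj : Pairwise (Function.onFun Disjoint
      fun k : ℕ => Set.Ico ((k : ℝ) / n) ((k + 1 : ℝ) / n)) := by
    intro i j hij
    refine Set.disjoint_left.2 fun x hi hj => hij ?_
    rw [← floor_mul_of_mem_Ico hn hi, floor_mul_of_mem_Ico hn hj]
  have hs := hasSum_integral_iUnion (μ := volume) (f := fun s : ℝ => F ⌊s * n⌋₊)
    (s := fun k : ℕ => Set.Ico ((k : ℝ) / n) ((k + 1 : ℝ) / n)) (fun _ => measurableSet_Ico) hdisj
    (by rw [iUnion_Ico_div_nat hn]; exact (integrableOn_Ici_iff_integrableOn_Ioi (by simp)).2 hF)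
  rw [iUnion_Ico_div_nat hn, integral_Ici_eq_integral_Ioi] at hs
  rw [← hs.tsum_eq, ← tsum_div_const]
  refine tsum_congr fun k => ?_
  rw [setIntegral_congr_fun (g := fun _ => F k) measurableSet_Ico
    (fun x hx => by simp only [floor_mul_of_mem_Ico hn hx]), setIntegral_const, smul_eq_mul,
    Measure.real, Real.volume_Ico, ENNReal.toReal_ofReal (by rw [← sub_div]; simp)]
  field_simp
  ring

/-- Karamata's Abelian theorem, along the points `1 - 1/n`. -/
theorem IsRegularlyVaryingSeq.tendsto_tsum_div {u : ℕ → ℝ} {ρ : ℝ} (hρ : ρ ∈ Set.Ioc (0 : ℝ) 1)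
    (h : IsRegularlyVaryingSeq u (ρ - 1)) (hu : ∀ n, 0 ≤ u n) :
    Tendsto (fun n : ℕ => (∑' k, u k * (1 - 1 / (n : ℝ)) ^ k) / (n * u n)) atTop
      (𝓝 (Real.Gamma ρ)) := by
  have hα : -1 ≤ ρ - 1 := by linarith [hρ.1]
  have hα' : ρ - 1 ≤ 0 := by linarith [hρ.2]
  obtain ⟨C, N₁, hC, hlow⟩ := h.potter_lower hu hα hα' (β := ρ / 2 - 1)
    (by linarith [hρ.1]) (by linarith [hρ.1])
  obtain ⟨N₂, hup⟩ := h.potter_upper hu hα hα'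
  obtain ⟨N₃, hN₃⟩ := eventually_atTop.1 (h.eventually_pos hu)
  set N := max (max N₁ N₂) (max N₃ 2) with hN
  let G : ℕ → ℕ → ℝ := fun n k => u k / u n * (1 - 1 / (n : ℝ)) ^ k
  -- With `k = ⌊s n⌋` the sum becomes an integral over `s > 0`, whose integrand tends to that of
  -- `Γ(ρ)`. Potter's bounds dominate it by two Gamma integrands, one for `k ≤ n` and one for `k ≥
  -- n`; the factor `e` pays for the integer part.
  let bound : ℝ → ℝ := fun s => Real.exp 1 * (C * (Real.exp (-s) * s ^ (ρ / 2 - 1)) +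
    16 * (Real.exp (-s) * s ^ ((2 : ℝ) - 1)))
  have hbint : Integrable bound (volume.restrict (Set.Ioi 0)) :=
    (((Real.GammaIntegral_convergent (half_pos hρ.1)).const_mul C).add
      ((Real.GammaIntegral_convergent two_pos).const_mul 16)).const_mul _
  have hmeas : ∀ n, AEStronglyMeasurable (fun s : ℝ => G n ⌊s * n⌋₊)
      (volume.restrict (Set.Ioi 0)) := fun n =>
    ((measurable_from_nat (f := G n)).comp (Nat.measurable_floor.comp
      (measurable_id.mul_const (n : ℝ)))).aestronglyMeasurable
  have hbound : ∀ n, N ≤ n → ∀ᵐ s : ℝ ∂(volume.restrict (Set.Ioi (0 : ℝ))),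
      ‖G n ⌊s * n⌋₊‖ ≤ bound s := by
    intro n hn
    refine (ae_restrict_iff' measurableSet_Ioi).2 (Eventually.of_forall fun s hs => ?_)
    have hs0 : (0 : ℝ) < s := hs
    have hn1 : (1 : ℝ) ≤ n := by exact_mod_cast (by omega : 1 ≤ n)
    have hn0 : (0 : ℝ) < n := by linarith
    have hun := hN₃ n (by omega)
    set k := ⌊s * n⌋₊ with hk
    have hk1 : (k : ℝ) ≤ s * n := Nat.floor_le (by positivity)
    have hk2 : s * n < (k + 1 : ℕ) := by exact_mod_cast Nat.lt_floor_add_one (s * n)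
    have hx0 : 0 ≤ 1 - 1 / (n : ℝ) := by
      rw [sub_nonneg, div_le_one hn0]; exact hn1
    have hx : (1 - 1 / (n : ℝ)) ^ k ≤ Real.exp 1 * Real.exp (-s) := by
      calc (1 - 1 / (n : ℝ)) ^ k ≤ (Real.exp (-(1 / (n : ℝ)))) ^ k :=
            pow_le_pow_left₀ hx0 (Real.one_sub_le_exp_neg _) k
        _ = Real.exp (k * -(1 / (n : ℝ))) := (Real.exp_nat_mul _ _).symm
        _ ≤ Real.exp (1 + -s) := by
            refine Real.exp_le_exp.2 ?_
            have : s - 1 ≤ k / (n : ℝ) := by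
              rw [le_div_iff₀ hn0]
              push_cast at hk2
              nlinarith
            calc (k : ℝ) * -(1 / (n : ℝ)) = -(k / n) := by ring
              _ ≤ 1 + -s := by linarith
        _ = _ := Real.exp_add _ _
    have hr : u k / u n ≤ C * s ^ (ρ / 2 - 1) + 16 * s ^ ((2 : ℝ) - 1) := by
      have p1 : 0 ≤ C * s ^ (ρ / 2 - 1) := by positivity
      have p2 : 0 ≤ 16 * s ^ ((2 : ℝ) - 1) := by positivity
      rcases le_total k n with hkn | hkn
      · have h1 := hlow n k (by omega) hkn
        have h2 : (s * n) ^ (-(ρ / 2 - 1)) ≤ ((k + 1 : ℕ) : ℝ) ^ (-(ρ / 2 - 1)) :=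
          Real.rpow_le_rpow (by positivity) hk2.le (by linarith [hρ.2])
        rw [Real.mul_rpow hs0.le hn0.le] at h2
        have h3 : s ^ (-(ρ / 2 - 1)) * (n : ℝ) ^ (-(ρ / 2 - 1)) * u k ≤
            C * ((n : ℝ) ^ (-(ρ / 2 - 1)) * u n) :=
          (mul_le_mul_of_nonneg_right h2 (hu k)).trans h1
        have h4 : s ^ (-(ρ / 2 - 1)) * u k ≤ C * u n := by
          have hp : 0 < (n : ℝ) ^ (-(ρ / 2 - 1)) := Real.rpow_pos_of_pos hn0 _
          refine le_of_mul_le_mul_left ?_ hp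
          linarith
        rw [Real.rpow_neg hs0.le, inv_mul_le_iff₀ (Real.rpow_pos_of_pos hs0 _)] at h4
        have : u k / u n ≤ C * s ^ (ρ / 2 - 1) := by
          rw [div_le_iff₀ hun]; linarith
        exact this.trans (le_add_of_nonneg_right p2)
      · have h1 := hup n k (by omega) hkn
        have : u k / u n ≤ 16 * s ^ ((2 : ℝ) - 1) := by
          rw [div_le_iff₀ hun, show (2 : ℝ) - 1 = 1 by norm_num, Real.rpow_one]
          refine le_of_mul_le_mul_left ?_ hn0
          nlinarith [mul_le_mul_of_nonneg_right hk1 hun.le]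
        exact this.trans (le_add_of_nonneg_left p1)
    have hG0 : 0 ≤ G n k := mul_nonneg (div_nonneg (hu k) (hu n)) (pow_nonneg hx0 k)
    rw [Real.norm_of_nonneg hG0]
    calc G n k ≤ (C * s ^ (ρ / 2 - 1) + 16 * s ^ ((2 : ℝ) - 1)) *
          (Real.exp 1 * Real.exp (-s)) :=
          mul_le_mul hr hx (pow_nonneg hx0 k) (by positivity)
      _ = bound s := by simp only [bound]; ring
  have hlim : ∀ᵐ s : ℝ ∂(volume.restrict (Set.Ioi (0 : ℝ))),
      Tendsto (fun n : ℕ => G n ⌊s * n⌋₊) atTop (𝓝 (Real.exp (-s) * s ^ (ρ - 1))) := by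
    refine (ae_restrict_iff' measurableSet_Ioi).2 (Eventually.of_forall fun s hs => ?_)
    rw [mul_comm]
    exact (h.tendsto_floor hs).mul (tendsto_one_sub_inv_pow_floor hs)
  have hmain := tendsto_integral_filter_of_dominated_convergence bound
    (Eventually.of_forall hmeas) ((eventually_ge_atTop N).mono hbound) hbint hlim
  rw [← Real.Gamma_eq_integral hρ.1] at hmain
  refine hmain.congr' ?_
  filter_upwards [eventually_ge_atTop N] with n hn
  have hint : IntegrableOn (fun s : ℝ => G n ⌊s * n⌋₊) (Set.Ioi 0) :=
    hbint.mono' (hmeas n) (hbound n hn)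
  rw [integral_comp_floor_mul (by omega) (G n) hint]
  have hun := hN₃ n (by omega)
  have : ∀ k, G n k = (u k * (1 - 1 / (n : ℝ)) ^ k) / u n := fun k => by simp only [G]; ring
  rw [tsum_congr this, tsum_div_const, div_div, mul_comm (u n)]

end Karamata

/-! ### The function `H` at real points and the infinite product. -/

section Renewal

variable {ψ : ℝ⟦X⟧}

theorem psValue_mul {F G : ℝ⟦X⟧} {x : ℝ}
    (hF : Summable fun n => ‖PowerSeries.coeff n F * x ^ n‖)
    (hG : Summable fun n => ‖PowerSeries.coeff n G * x ^ n‖) :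
    psValue (F * G) x = psValue F x * psValue G x := by
  rw [psValue, psValue, psValue, tsum_mul_tsum_eq_tsum_sum_antidiagonal_of_summable_norm hF hG]
  refine tsum_congr fun n => ?_
  rw [PowerSeries.coeff_mul, Finset.sum_mul]
  refine Finset.sum_congr rfl fun p hp => ?_
  rw [← Finset.HasAntidiagonal.mem_antidiagonal.1 hp, pow_add]
  ring

theorem psValue_rescale (F : ℝ⟦X⟧) (a x : ℝ) :
    psValue (PowerSeries.rescale a F) x = psValue F (a * x) := by
  refine tsum_congr fun n => ?_
  rw [PowerSeries.coeff_rescale, mul_pow]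
  ring

theorem isUnit_one_sub_pow {q : ℝ} (hq : 0 ≤ q) (hq1 : q < 1) (m : ℕ) (hm : m ≠ 0) :
    IsUnit (1 - q ^ m) :=
  (sub_pos.2 (pow_lt_one₀ hq hq1 hm)).ne'.isUnit

theorem qRenewal_real_eq {q : ℝ} {m : ℕ} (hm : m ≠ 0) :
    qRenewal q ψ m = (1 - q ^ m)⁻¹ *
      ∑ k ∈ Finset.range m, PowerSeries.coeff (m - k) ψ * qRenewal q ψ k := by
  rw [qRenewal_eq q ψ hm, Ring.inverse_eq_inv']

theorem qRenewal_nonneg (hψ : ∀ i, 0 ≤ PowerSeries.coeff i ψ) {q : ℝ} (hq : 0 ≤ q)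
    (hq1 : q < 1) (m : ℕ) : 0 ≤ qRenewal q ψ m := by
  induction m using Nat.strong_induction_on with
  | _ m ih =>
    rcases eq_or_ne m 0 with rfl | hm
    · rw [qRenewal_zero]; exact zero_le_one
    · rw [qRenewal_real_eq hm]
      refine mul_nonneg (inv_nonneg.2 (sub_nonneg.2 (pow_le_one₀ hq hq1.le))) ?_
      exact Finset.sum_nonneg fun k hk => mul_nonneg (hψ _) (ih k (Finset.mem_range.1 hk))

/-- As `∑ ψᵢ = 1`, the recursion gives `c_m ≤ (1 - q^m)⁻¹ max_{k<m} c_k`. The product of these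
factors is at most the exponential of `∑ qⁱ/(1 - q)`. -/
theorem qRenewal_bounded (hψ : ∀ i, 0 ≤ PowerSeries.coeff i ψ)
    (hsum : HasSum (fun n => PowerSeries.coeff n ψ) 1) {q : ℝ} (hq : 0 ≤ q) (hq1 : q < 1) :
    ∃ B : ℝ, 0 < B ∧ ∀ m, qRenewal q ψ m ≤ B := by
  have hq1' : 0 < 1 - q := sub_pos.2 hq1
  have hS : Summable fun i : ℕ => q ^ (i + 1) / (1 - q) :=
    ((summable_nat_add_iff 1).2 (summable_geometric_of_lt_one hq hq1)).div_const _
  have hnn : ∀ i : ℕ, 0 ≤ q ^ (i + 1) / (1 - q) := fun i => by positivity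
  refine ⟨Real.exp (∑' i : ℕ, q ^ (i + 1) / (1 - q)), Real.exp_pos _, fun m => ?_⟩
  refine le_trans ?_ (Real.exp_le_exp.2 (hS.sum_le_tsum (Finset.range m) fun i _ => hnn i))
  induction m using Nat.strong_induction_on with
  | _ m ih =>
    rcases eq_or_ne m 0 with rfl | hm
    · simp [qRenewal_zero]
    obtain ⟨n, rfl⟩ := Nat.exists_eq_succ_of_ne_zero hm
    set E := Real.exp (∑ i ∈ Finset.range n, q ^ (i + 1) / (1 - q)) with hE
    have h1 : ∑ k ∈ Finset.range (n + 1), PowerSeries.coeff (n + 1 - k) ψ * qRenewal q ψ k ≤ E := by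
      calc _ ≤ ∑ k ∈ Finset.range (n + 1), PowerSeries.coeff (n + 1 - k) ψ * E := by
            refine Finset.sum_le_sum fun k hk => mul_le_mul_of_nonneg_left ?_ (hψ _)
            have hk' := Finset.mem_range.1 hk
            refine (ih k hk').trans (Real.exp_le_exp.2 ?_)
            exact Finset.sum_le_sum_of_subset_of_nonneg
              (Finset.range_subset_range.2 (Nat.lt_succ_iff.1 hk')) fun i _ _ => hnn i
        _ = (∑ k ∈ Finset.range (n + 1), PowerSeries.coeff (k + 1) ψ) * E := by
            rw [← Finset.sum_mul, ← Finset.sum_range_reflect]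
            congr 1
            refine Finset.sum_congr rfl fun k hk => ?_
            have := Finset.mem_range.1 hk
            congr 2
            omega
        _ ≤ 1 * E := by
            refine mul_le_mul_of_nonneg_right ?_ (Real.exp_pos _).le
            calc _ ≤ ∑ k ∈ Finset.range (n + 2), PowerSeries.coeff k ψ := by
                  rw [Finset.sum_range_succ' _ (n + 1)]
                  linarith [hψ 0]
              _ ≤ 1 := sum_le_hasSum _ (fun i _ => hψ i) hsum
        _ = E := one_mul E
    have hx1 : q ^ (n + 1) ≤ q := by
      calc q ^ (n + 1) ≤ q ^ 1 := pow_le_pow_of_le_one hq hq1.le (by omega)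
        _ = q := pow_one q
    have hx : 0 < 1 - q ^ (n + 1) := by linarith
    have h2 : (1 - q ^ (n + 1))⁻¹ ≤ Real.exp (q ^ (n + 1) / (1 - q)) := by
      have h3 : (1 - q ^ (n + 1))⁻¹ = q ^ (n + 1) / (1 - q ^ (n + 1)) + 1 := by
        field_simp; ring
      have h4 : q ^ (n + 1) / (1 - q ^ (n + 1)) ≤ q ^ (n + 1) / (1 - q) :=
        div_le_div_of_nonneg_left (by positivity) hq1' (by linarith)
      rw [h3]
      exact (add_le_add_left h4 1).trans (Real.add_one_le_exp _)
    rw [qRenewal_real_eq hm, Finset.sum_range_succ (fun i => q ^ (i + 1) / (1 - q)), Real.exp_add, ← hE, mul_comm E]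
    exact mul_le_mul h2 h1 (Finset.sum_nonneg fun k _ =>
      mul_nonneg (hψ _) (qRenewal_nonneg hψ hq hq1 k)) (Real.exp_pos _).le

theorem summable_qRenewal (hψ : ∀ i, 0 ≤ PowerSeries.coeff i ψ)
    (hsum : HasSum (fun n => PowerSeries.coeff n ψ) 1) {q : ℝ} (hq : 0 ≤ q) (hq1 : q < 1)
    {x : ℝ} (hx : 0 ≤ x) (hx1 : x < 1) : Summable fun n => qRenewal q ψ n * x ^ n := by
  obtain ⟨B, _, hB⟩ := qRenewal_bounded hψ hsum hq hq1
  exact Summable.of_nonneg_of_le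
    (fun n => mul_nonneg (qRenewal_nonneg hψ hq hq1 n) (pow_nonneg hx n))
    (fun n => mul_le_mul_of_nonneg_right (hB n) (pow_nonneg hx n))
    ((summable_geometric_of_lt_one hx hx1).mul_left B)

theorem summable_coeff_mul_pow (hψ : ∀ i, 0 ≤ PowerSeries.coeff i ψ)
    (hsum : HasSum (fun n => PowerSeries.coeff n ψ) 1) {x : ℝ} (hx : 0 ≤ x) (hx1 : x ≤ 1) :
    Summable fun n => PowerSeries.coeff n ψ * x ^ n :=
  Summable.of_nonneg_of_le (fun n => mul_nonneg (hψ n) (pow_nonneg hx n))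
    (fun n => mul_le_of_le_one_right (hψ n) (pow_le_one₀ hx hx1)) hsum.summable

theorem psValue_nonneg (hψ : ∀ i, 0 ≤ PowerSeries.coeff i ψ) {x : ℝ} (hx : 0 ≤ x) :
    0 ≤ psValue ψ x :=
  tsum_nonneg fun n => mul_nonneg (hψ n) (pow_nonneg hx n)

theorem psValue_le_self (hψ0 : PowerSeries.constantCoeff ψ = 0)
    (hψ : ∀ i, 0 ≤ PowerSeries.coeff i ψ)
    (hsum : HasSum (fun n => PowerSeries.coeff n ψ) 1) {x : ℝ} (hx : 0 ≤ x) (hx1 : x ≤ 1) :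
    psValue ψ x ≤ x := by
  have h : ∀ n, PowerSeries.coeff n ψ * x ^ n ≤ PowerSeries.coeff n ψ * x := by
    intro n
    rcases n.eq_zero_or_pos with rfl | hn
    · simp [hψ0]
    · refine mul_le_mul_of_nonneg_left ?_ (hψ n)
      calc x ^ n ≤ x ^ 1 := pow_le_pow_of_le_one hx hx1 hn
        _ = x := pow_one x
  have := (summable_coeff_mul_pow hψ hsum hx hx1).tsum_le_tsum h (hsum.summable.mul_right x)
  rwa [tsum_mul_right, hsum.tsum_eq, one_mul] at this

theorem psValue_one_sub {x : ℝ} (h : Summable fun n => PowerSeries.coeff n ψ * x ^ n) :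
    psValue (1 - ψ) x = 1 - psValue ψ x := by
  have h1 : HasSum (fun n => PowerSeries.coeff n (1 : ℝ⟦X⟧) * x ^ n) 1 := by
    convert hasSum_ite_eq (0 : ℕ) (1 : ℝ) using 2 with n
    rw [PowerSeries.coeff_one]
    split_ifs with hn <;> simp [hn]
  have := h1.sub h.hasSum
  rw [psValue, psValue, ← this.tsum_eq]
  exact tsum_congr fun n => by rw [map_sub]; ring

/-- The functional equation `H(x) (1 - ψ(x)) = H(q x)`. -/
theorem psValue_qRenewal_mul (hψ0 : PowerSeries.constantCoeff ψ = 0)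
    (hψ : ∀ i, 0 ≤ PowerSeries.coeff i ψ)
    (hsum : HasSum (fun n => PowerSeries.coeff n ψ) 1) {q : ℝ} (hq : 0 ≤ q) (hq1 : q < 1)
    {x : ℝ} (hx : 0 ≤ x) (hx1 : x < 1) :
    psValue (PowerSeries.mk (qRenewal q ψ)) x * (1 - psValue ψ x) =
      psValue (PowerSeries.mk (qRenewal q ψ)) (q * x) := by
  have hs := summable_coeff_mul_pow hψ hsum hx hx1.le
  have h1 : Summable fun n => PowerSeries.coeff n (1 - ψ) * x ^ n := by
    have : Summable fun n => PowerSeries.coeff n (1 : ℝ⟦X⟧) * x ^ n :=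
      summable_of_ne_finset_zero (s := {0}) fun n hn => by
        rw [PowerSeries.coeff_one, if_neg (by simpa using hn), zero_mul]
    refine (this.sub hs).congr fun n => ?_
    rw [map_sub]; ring
  rw [← psValue_one_sub hs, ← psValue_mul _ h1.norm,
    qRenewal_mul_one_sub (isUnit_one_sub_pow hq hq1) hψ0, psValue_rescale]
  simpa only [PowerSeries.coeff_mk] using (summable_qRenewal hψ hsum hq hq1 hx hx1).norm

theorem psValue_mk_qRenewal (q x : ℝ) :
    psValue (PowerSeries.mk (qRenewal q ψ)) x = ∑' n, qRenewal q ψ n * x ^ n := by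
  simp only [psValue, PowerSeries.coeff_mk]

theorem one_le_psValue_qRenewal (hψ : ∀ i, 0 ≤ PowerSeries.coeff i ψ)
    (hsum : HasSum (fun n => PowerSeries.coeff n ψ) 1) {q : ℝ} (hq : 0 ≤ q) (hq1 : q < 1)
    {x : ℝ} (hx : 0 ≤ x) (hx1 : x < 1) :
    1 ≤ psValue (PowerSeries.mk (qRenewal q ψ)) x := by
  rw [psValue_mk_qRenewal]
  have := (summable_qRenewal hψ hsum hq hq1 hx hx1).sum_le_tsum {0} fun n _ =>
    mul_nonneg (qRenewal_nonneg hψ hq hq1 n) (pow_nonneg hx n)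
  simpa [qRenewal_zero] using this

theorem tendsto_psValue_qRenewal_pow (hψ : ∀ i, 0 ≤ PowerSeries.coeff i ψ)
    (hsum : HasSum (fun n => PowerSeries.coeff n ψ) 1) {q : ℝ} (hq : 0 ≤ q) (hq1 : q < 1) :
    Tendsto (fun n : ℕ => psValue (PowerSeries.mk (qRenewal q ψ)) (q ^ (n + 1))) atTop (𝓝 1) := by
  simp only [psValue_mk_qRenewal]
  have h1 : ∑' k : ℕ, (if k = 0 then (1 : ℝ) else 0) = 1 := tsum_ite_eq 0 _
  rw [← h1]
  refine tendsto_tsum_of_dominated_convergence (summable_qRenewal hψ hsum hq hq1 hq hq1)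
    (fun k => ?_) (Eventually.of_forall fun n k => ?_)
  · rcases eq_or_ne k 0 with rfl | hk
    · simp [qRenewal_zero]
    · rw [if_neg hk]
      have h2 := (tendsto_pow_atTop_nhds_zero_of_lt_one hq hq1).comp (tendsto_add_atTop_nat 1)
      simpa [hk] using (h2.pow k).const_mul (qRenewal q ψ k)
  · have hc := qRenewal_nonneg hψ hq hq1 k
    rw [Real.norm_of_nonneg (mul_nonneg hc (by positivity))]
    refine mul_le_mul_of_nonneg_left (pow_le_pow_left₀ (by positivity) ?_ k) hc
    calc q ^ (n + 1) ≤ q ^ 1 := pow_le_pow_of_le_one hq hq1.le (by omega)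
      _ = q := pow_one q

theorem prod_one_sub_mul_psValue (hψ0 : PowerSeries.constantCoeff ψ = 0)
    (hψ : ∀ i, 0 ≤ PowerSeries.coeff i ψ)
    (hsum : HasSum (fun n => PowerSeries.coeff n ψ) 1) {q : ℝ} (hq : 0 ≤ q) (hq1 : q < 1) (n : ℕ) :
    (∏ j ∈ Finset.range n, (1 - psValue ψ (q ^ (j + 1)))) *
      psValue (PowerSeries.mk (qRenewal q ψ)) q =
      psValue (PowerSeries.mk (qRenewal q ψ)) (q ^ (n + 1)) := by
  induction n with
  | zero => simp
  | succ n ih =>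
    rw [Finset.prod_range_succ, mul_right_comm, ih, psValue_qRenewal_mul hψ0 hψ hsum hq hq1
      (by positivity) (pow_lt_one₀ hq hq1 (by omega)), ← pow_succ']

theorem multipliable_one_sub_psValue (hψ0 : PowerSeries.constantCoeff ψ = 0)
    (hψ : ∀ i, 0 ≤ PowerSeries.coeff i ψ)
    (hsum : HasSum (fun n => PowerSeries.coeff n ψ) 1) {q : ℝ} (hq : 0 ≤ q) (hq1 : q < 1) :
    Multipliable fun j : ℕ => 1 - psValue ψ (q ^ (j + 1)) := by
  simp only [sub_eq_add_neg]
  refine Real.multipliable_one_add_of_summable (Summable.neg ?_)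
  exact Summable.of_nonneg_of_le (fun j => psValue_nonneg hψ (by positivity))
    (fun j => psValue_le_self hψ0 hψ hsum (by positivity) (pow_le_one₀ hq hq1.le))
    ((summable_nat_add_iff 1).2 (summable_geometric_of_lt_one hq hq1))

/-- Iterating the functional equation from `q` gives `H(q)` times a partial product `= H(q^(n+1))`,
which tends to `H(0) = 1`. -/
theorem tprod_one_sub_psValue (hψ0 : PowerSeries.constantCoeff ψ = 0)
    (hψ : ∀ i, 0 ≤ PowerSeries.coeff i ψ)
    (hsum : HasSum (fun n => PowerSeries.coeff n ψ) 1) {q : ℝ} (hq : 0 ≤ q) (hq1 : q < 1) :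
    ∏' j : ℕ, (1 - psValue ψ (q ^ (j + 1))) =
      (psValue (PowerSeries.mk (qRenewal q ψ)) q)⁻¹ := by
  have h1 := (multipliable_one_sub_psValue hψ0 hψ hsum hq hq1).hasProd.tendsto_prod_nat
  have h2 := h1.mul_const (psValue (PowerSeries.mk (qRenewal q ψ)) q)
  simp only [prod_one_sub_mul_psValue hψ0 hψ hsum hq hq1] at h2
  exact eq_inv_of_mul_eq_one_left
    (tendsto_nhds_unique h2 (tendsto_psValue_qRenewal_pow hψ hsum hq hq1))

/-- The coefficients of `1 / (1 - ψ)`. -/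
theorem mk_qRenewal_zero (hψ0 : PowerSeries.constantCoeff ψ = 0) :
    PowerSeries.mk (qRenewal 0 ψ) = (1 - ψ)⁻¹ := by
  have h1 : PowerSeries.constantCoeff (1 - ψ) ≠ 0 := by simp [hψ0]
  -- At `q = 0` the functional equation reads `H (1 - ψ) = H(0) = 1`, so the facts proved on `cₙ`
  -- apply to `uₙ`.
  rw [PowerSeries.eq_inv_iff_mul_eq_one h1,
    qRenewal_mul_one_sub (isUnit_one_sub_pow le_rfl zero_lt_one) hψ0]
  ext n
  rw [PowerSeries.coeff_rescale, PowerSeries.coeff_mk, PowerSeries.coeff_one]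
  split_ifs with h
  · simp [h, qRenewal_zero]
  · simp [h]

theorem coeff_inv_one_sub (hψ0 : PowerSeries.constantCoeff ψ = 0) (n : ℕ) :
    PowerSeries.coeff n (1 - ψ)⁻¹ = qRenewal 0 ψ n := by
  rw [← mk_qRenewal_zero hψ0, PowerSeries.coeff_mk]

theorem tsum_coeff_inv_mul (hψ0 : PowerSeries.constantCoeff ψ = 0)
    (hψ : ∀ i, 0 ≤ PowerSeries.coeff i ψ)
    (hsum : HasSum (fun n => PowerSeries.coeff n ψ) 1) {x : ℝ} (hx : 0 ≤ x) (hx1 : x < 1) :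
    (∑' n, PowerSeries.coeff n (1 - ψ)⁻¹ * x ^ n) * (1 - psValue ψ x) = 1 := by
  have h := psValue_qRenewal_mul hψ0 hψ hsum le_rfl zero_lt_one hx hx1
  rw [mk_qRenewal_zero hψ0, zero_mul] at h
  rw [← psValue, h, psValue, tsum_eq_single 0 fun n hn => by simp [hn],
    coeff_inv_one_sub hψ0, qRenewal_zero, pow_zero, mul_one]

/-- The sum in Karamata's theorem is `∑ uₖ xᵏ = 1/(1 - ψ(x))` at `x = 1 - 1/n`; the limit is
inverted. -/
theorem tendsto_norming {ρ : ℝ} (hρ : ρ ∈ Set.Ioc (0 : ℝ) 1)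
    (hψ0 : PowerSeries.constantCoeff ψ = 0) (hψ : ∀ i, 0 ≤ PowerSeries.coeff i ψ)
    (hsum : HasSum (fun n => PowerSeries.coeff n ψ) 1)
    (h : IsRegularlyVaryingSeq (fun n => PowerSeries.coeff n (1 - ψ)⁻¹) (ρ - 1)) :
    Tendsto (fun n : ℕ => (n : ℝ) * (1 - psValue ψ (1 - 1 / (n : ℝ))) *
      PowerSeries.coeff n (1 - ψ)⁻¹) atTop (𝓝 (Real.Gamma ρ)⁻¹) := by
  have hu : ∀ n, 0 ≤ PowerSeries.coeff n (1 - ψ)⁻¹ := fun n => by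
    rw [coeff_inv_one_sub hψ0]; exact qRenewal_nonneg hψ le_rfl zero_lt_one n
  refine ((h.tendsto_tsum_div hρ hu).inv₀ (Real.Gamma_pos_of_pos hρ.1).ne').congr' ?_
  filter_upwards [eventually_ge_atTop 1] with n hn
  have hn1 : (1 : ℝ) ≤ n := by exact_mod_cast hn
  have hx : 0 ≤ 1 - 1 / (n : ℝ) := by
    rw [sub_nonneg, div_le_one (by linarith)]; exact hn1
  have hx1 : 1 - 1 / (n : ℝ) < 1 := by
    have : 0 < 1 / (n : ℝ) := by positivity
    linarith
  have e := eq_inv_of_mul_eq_one_left (tsum_coeff_inv_mul hψ0 hψ hsum hx hx1)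
  rw [e, inv_div, div_inv_eq_mul]
  ring

end Renewal

/-! ### Sequences with equivalent consecutive terms. -/

section Ratio

variable {u : ℕ → ℝ}

theorem tendsto_div_add (hne : ∀ᶠ n in atTop, u n ≠ 0)
    (h : Tendsto (fun n => u (n + 1) / u n) atTop (𝓝 1)) (i : ℕ) :
    Tendsto (fun n => u n / u (n + i)) atTop (𝓝 1) := by
  induction i with
  | zero =>
    refine tendsto_const_nhds.congr' ?_
    filter_upwards [hne] with n hn using (div_self hn).symm
  | succ i ih =>
    have h1 := ih.mul ((h.comp (tendsto_add_atTop_nat i)).inv₀ one_ne_zero)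
    rw [inv_one, mul_one] at h1
    refine h1.congr' ?_
    filter_upwards [(tendsto_add_atTop_nat i).eventually hne] with n hn
    simp only [Function.comp, inv_div]
    rw [div_mul_div_cancel₀ hn, add_assoc]

theorem tendsto_sub_div (hne : ∀ᶠ n in atTop, u n ≠ 0)
    (h : Tendsto (fun n => u (n + 1) / u n) atTop (𝓝 1)) (i : ℕ) :
    Tendsto (fun n => u (n - i) / u n) atTop (𝓝 1) := by
  rw [← tendsto_add_atTop_iff_nat i]
  simpa using tendsto_div_add hne h i

/-- If consecutive terms are equivalent, then quotients of terms grow slower than any geometric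
sequence. -/
theorem exists_le_mul_pow (hu : ∀ n, 0 ≤ u n) (hpos : ∀ᶠ n in atTop, 0 < u n)
    (h : Tendsto (fun n => u (n + 1) / u n) atTop (𝓝 1)) {r : ℝ} (hr : 1 < r) :
    ∃ (C : ℝ) (N : ℕ), 0 < C ∧ ∀ n, N ≤ n → 0 < u n ∧ ∀ k, k ≤ n → u k ≤ C * r ^ (n - k) * u n := by
  have hr0 : 0 < r := by linarith
  have hev := hpos.and (h.eventually_const_lt (inv_lt_one_of_one_lt₀ hr))
  obtain ⟨N, hN⟩ := eventually_atTop.1 hev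
  have hstep : ∀ n, N ≤ n → u n ≤ r * u (n + 1) := by
    intro n hn
    have := (hN n hn).2
    rw [lt_div_iff₀ (hN n hn).1, inv_mul_eq_div, div_lt_iff₀ hr0] at this
    linarith
  have huN := (hN N le_rfl).1
  have hnn : ∀ k ∈ Finset.range N, 0 ≤ u k / u N := fun k _ => div_nonneg (hu k) huN.le
  have hsum := Finset.sum_nonneg hnn
  set C := 1 + ∑ k ∈ Finset.range N, u k / u N with hC
  have hC1 : 1 ≤ C := by linarith
  refine ⟨C, N, by linarith, fun n hn => ⟨(hN n hn).1, ?_⟩⟩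
  induction n, hn using Nat.le_induction with
  | base =>
    intro k hk
    have h1 : u k ≤ C * u N := by
      rw [← div_le_iff₀ huN]
      rcases hk.lt_or_eq with hk | rfl
      · have := Finset.single_le_sum hnn (Finset.mem_range.2 hk)
        linarith
      · rw [div_self huN.ne']; exact hC1
    have h2 : 1 ≤ r ^ (N - k) := one_le_pow₀ hr.le
    calc u k ≤ C * u N := h1
      _ = C * 1 * u N := by ring
      _ ≤ _ := by gcongr
  | succ n hn ih =>
    intro k hk
    rcases hk.lt_or_eq with hk | rfl
    · have h1 := ih k (Nat.lt_succ_iff.1 hk)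
      calc u k ≤ C * r ^ (n - k) * u n := h1
        _ ≤ C * r ^ (n - k) * (r * u (n + 1)) :=
            mul_le_mul_of_nonneg_left (hstep n hn) (by positivity)
        _ = _ := by rw [Nat.succ_sub (Nat.lt_succ_iff.1 hk), pow_succ]; ring
    · rw [Nat.sub_self, pow_zero, mul_one]
      nlinarith [hu (n + 1)]

end Ratio

/-! ### Asymptotics of `cₙ` and `bₙ` at a fixed real `q`. -/

section Asymptotics

variable {ψ : ℝ⟦X⟧}

theorem tendsto_qRenewal_div (hψ0 : PowerSeries.constantCoeff ψ = 0)
    (hψ : ∀ i, 0 ≤ PowerSeries.coeff i ψ)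
    (hsum : HasSum (fun n => PowerSeries.coeff n ψ) 1) {u : ℕ → ℝ}
    (hu : ∀ n, u n = PowerSeries.coeff n (1 - ψ)⁻¹) (hunn : ∀ n, 0 ≤ u n)
    (hpos : ∀ᶠ n in atTop, 0 < u n)
    (h : Tendsto (fun n => u (n + 1) / u n) atTop (𝓝 1)) {q : ℝ} (hq : 0 < q) (hq1 : q < 1) :
    Tendsto (fun n => qRenewal q ψ n / u n) atTop
      (𝓝 (psValue (PowerSeries.mk (qRenewal q ψ)) q)) := by
  have hne : ∀ᶠ n in atTop, u n ≠ 0 := hpos.mono fun n hn => hn.ne'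
  -- The rate `r` is chosen with `r > 1` and `r q = (1 + q)/2 < 1`: then `u_{n-i}/uₙ ≤ C rⁱ` is
  -- summable against `cᵢ qⁱ`.
  have hr : 1 < (1 + q) / (2 * q) := by rw [one_lt_div (by positivity)]; linarith
  obtain ⟨C, N, hC, hN⟩ := exists_le_mul_pow hunn hpos h hr
  set r := (1 + q) / (2 * q) with hrdef
  have hrq : r * q = (1 + q) / 2 := by rw [hrdef]; field_simp
  have hc := qRenewal_nonneg hψ hq.le hq1
  let F : ℕ → ℕ → ℝ := fun n i => if i ≤ n then u (n - i) / u n * (qRenewal q ψ i * q ^ i) else 0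
  have hF : ∀ n, ∑' i, F n i = qRenewal q ψ n / u n := by
    intro n
    have hinv : (1 - ψ)⁻¹ * (1 - ψ) = 1 :=
      PowerSeries.inv_mul_cancel _ (by simp [hψ0])
    rw [qRenewal_eq_sum (isUnit_one_sub_pow hq.le hq1) hψ0 hinv, Finset.sum_div,
      tsum_eq_sum (s := Finset.range (n + 1))]
    · refine Finset.sum_congr rfl fun i hi => ?_
      simp only [F]
      rw [if_pos (Nat.lt_succ_iff.1 (Finset.mem_range.1 hi)), ← hu]
      ring
    · intro i hi
      exact if_neg (by simpa using hi)
  have hb : Summable fun i => C * (qRenewal q ψ i * (r * q) ^ i) :=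
    (summable_qRenewal hψ hsum hq.le hq1 (by positivity) (by rw [hrq]; linarith)).mul_left C
  rw [psValue_mk_qRenewal]
  refine (tendsto_tsum_of_dominated_convergence hb (fun i => ?_) ?_).congr hF
  · have := (tendsto_sub_div hne h i).mul_const (qRenewal q ψ i * q ^ i)
    rw [one_mul] at this
    refine this.congr' ?_
    filter_upwards [eventually_ge_atTop i] with n hn
    simp only [F, if_pos hn]
  · filter_upwards [eventually_ge_atTop N] with n hn i
    obtain ⟨hun, hk⟩ := hN n hn
    simp only [F]
    split_ifs with hi
    · have h1 := hk (n - i) (Nat.sub_le n i)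
      rw [Nat.sub_sub_self hi, ← div_le_iff₀ hun] at h1
      have h2 : 0 ≤ qRenewal q ψ i * q ^ i := mul_nonneg (hc i) (by positivity)
      rw [Real.norm_of_nonneg (mul_nonneg (div_nonneg (hunn _) hun.le) h2)]
      calc _ ≤ C * r ^ i * (qRenewal q ψ i * q ^ i) := mul_le_mul_of_nonneg_right h1 h2
        _ = _ := by rw [mul_pow]; ring
    · rw [norm_zero]
      exact mul_nonneg hC.le (mul_nonneg (hc i) (by positivity))

theorem abs_qInv_sub_le {q B : ℝ} (hψ0 : PowerSeries.constantCoeff ψ = 0)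
    (hψ : ∀ i, 0 ≤ PowerSeries.coeff i ψ) (hq : 0 < q) (hq1 : q < 1)
    (hcB : ∀ m, qRenewal q ψ m ≤ B) (n : ℕ) :
    |qInv q ψ (n + 1) - qRenewal q ψ n| ≤
      B * q ^ n * ∑ k ∈ Finset.range n, |qInv q ψ (k + 1)| := by
  rw [qInv_succ (isUnit_one_sub_pow hq.le hq1) hψ0, sub_sub_cancel_left, abs_neg, Finset.mul_sum]
  refine (Finset.abs_sum_le_sum_abs _ _).trans (Finset.sum_le_sum fun k hk => ?_)
  have hk' := Finset.mem_range.1 hk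
  have h1 : q ^ ((k + 1) * (n - k)) ≤ q ^ n := by
    refine pow_le_pow_of_le_one hq.le hq1.le ?_
    obtain ⟨l, rfl⟩ : ∃ l, n = k + 1 + l := ⟨n - (k + 1), by omega⟩
    rw [show k + 1 + l - k = l + 1 by omega]
    nlinarith [Nat.zero_le (k * l)]
  have hc := qRenewal_nonneg hψ hq.le hq1 (n - k)
  rw [abs_mul, abs_of_nonneg (mul_nonneg (by positivity) hc), mul_comm, mul_comm B]
  exact mul_le_mul_of_nonneg_right (mul_le_mul h1 (hcB _) hc (by positivity)) (abs_nonneg _)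

/-- Once `B n qⁿ ≤ 1/2`, a bound `K ≥ 2B` for the earlier terms passes to the next: `cₙ ≤ K/2` and
the correction is at most `K/2`. -/
theorem exists_abs_qInv_le {q B : ℝ} (hψ0 : PowerSeries.constantCoeff ψ = 0)
    (hψ : ∀ i, 0 ≤ PowerSeries.coeff i ψ) (hq : 0 < q) (hq1 : q < 1) (hB : 0 < B)
    (hcB : ∀ m, qRenewal q ψ m ≤ B) : ∃ K : ℝ, 0 ≤ K ∧ ∀ n, |qInv q ψ n| ≤ K := by
  have hlim := (tendsto_self_mul_const_pow_of_lt_one hq.le hq1).const_mul B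
  rw [mul_zero] at hlim
  obtain ⟨N, hN⟩ := eventually_atTop.1 (hlim.eventually_le_const (half_pos one_pos))
  have hnn : ∀ k ∈ Finset.range (N + 1), 0 ≤ |qInv q ψ k| := fun k _ => abs_nonneg _
  have hs := Finset.sum_nonneg hnn
  set K := 2 * B + ∑ k ∈ Finset.range (N + 1), |qInv q ψ k| with hK
  have hK0 : 0 ≤ K := by linarith
  refine ⟨K, hK0, fun n => ?_⟩
  induction n using Nat.strong_induction_on with
  | _ n ih =>
    by_cases hn : n < N + 1
    · have := Finset.single_le_sum hnn (Finset.mem_range.2 hn)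
      linarith
    obtain ⟨m, rfl⟩ : ∃ m, n = m + 1 := ⟨n - 1, by omega⟩
    have h1 := abs_qInv_sub_le hψ0 hψ hq hq1 hcB m
    have h2 : ∑ k ∈ Finset.range m, |qInv q ψ (k + 1)| ≤ m * K := by
      have := Finset.sum_le_card_nsmul (Finset.range m) (fun k => |qInv q ψ (k + 1)|) K
        fun k hk => ih (k + 1) (by have := Finset.mem_range.1 hk; omega)
      simpa using this
    have h3 := hN m (by omega)
    have h4 : B * q ^ m * ∑ k ∈ Finset.range m, |qInv q ψ (k + 1)| ≤ 1 / 2 * K := by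
      calc _ ≤ B * q ^ m * (m * K) := mul_le_mul_of_nonneg_left h2 (by positivity)
        _ = B * (m * q ^ m) * K := by ring
        _ ≤ 1 / 2 * K := mul_le_mul_of_nonneg_right h3 hK0
    have h5 := abs_le.1 (h1.trans h4)
    have h6 := qRenewal_nonneg hψ hq.le hq1 m
    have h7 := hcB m
    rw [abs_le]
    constructor <;> linarith [h5.1, h5.2]

theorem tendsto_qInv_div (hψ0 : PowerSeries.constantCoeff ψ = 0)
    (hψ : ∀ i, 0 ≤ PowerSeries.coeff i ψ)
    (hsum : HasSum (fun n => PowerSeries.coeff n ψ) 1) {u : ℕ → ℝ}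
    (hu : ∀ n, u n = PowerSeries.coeff n (1 - ψ)⁻¹) (hunn : ∀ n, 0 ≤ u n)
    (hpos : ∀ᶠ n in atTop, 0 < u n)
    (h : Tendsto (fun n => u (n + 1) / u n) atTop (𝓝 1)) {q : ℝ} (hq : 0 < q) (hq1 : q < 1) :
    Tendsto (fun n => qInv q ψ n / u n) atTop
      (𝓝 (psValue (PowerSeries.mk (qRenewal q ψ)) q)) := by
  have hne : ∀ᶠ n in atTop, u n ≠ 0 := hpos.mono fun n hn => hn.ne'
  obtain ⟨B, hB, hcB⟩ := qRenewal_bounded hψ hsum hq.le hq1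
  obtain ⟨K, hK, hbK⟩ := exists_abs_qInv_le hψ0 hψ hq hq1 hB hcB
  have hr : 1 < (1 + q) / (2 * q) := by rw [one_lt_div (by positivity)]; linarith
  obtain ⟨C, N, hC, hN⟩ := exists_le_mul_pow hunn hpos h hr
  set r := (1 + q) / (2 * q) with hrdef
  have hrq : r * q = (1 + q) / 2 := by rw [hrdef]; field_simp
  have hr0 : 0 < r := by linarith
  have huN := (hN N le_rfl).1
  -- The difference is `O(n qⁿ)`, while `uₙ` is at least a constant times `r⁻ⁿ` with `r q < 1`.
  have herr : Tendsto (fun n => (qInv q ψ (n + 1) - qRenewal q ψ n) / u n) atTop (𝓝 0) := by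
    have hlim := (tendsto_self_mul_const_pow_of_lt_one (r := r * q) (by positivity)
      (by rw [hrq]; linarith)).const_mul (B * K * C / u N)
    rw [mul_zero] at hlim
    refine squeeze_zero_norm' ?_ hlim
    filter_upwards [eventually_ge_atTop N] with n hn
    obtain ⟨hun, hk⟩ := hN n hn
    have h1 := abs_qInv_sub_le hψ0 hψ hq hq1 hcB n
    have h2 : ∑ k ∈ Finset.range n, |qInv q ψ (k + 1)| ≤ n * K := by
      have := Finset.sum_le_card_nsmul (Finset.range n) (fun k => |qInv q ψ (k + 1)|) K
        fun k _ => hbK (k + 1)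
      simpa using this
    have h3 : u N ≤ C * r ^ n * u n := by
      refine (hk N hn).trans (mul_le_mul_of_nonneg_right (mul_le_mul_of_nonneg_left ?_ hC.le) hun.le)
      exact pow_le_pow_right₀ hr.le (Nat.sub_le n N)
    rw [Real.norm_eq_abs, abs_div, abs_of_pos hun, div_le_iff₀ hun]
    calc _ ≤ B * q ^ n * (n * K) := h1.trans (mul_le_mul_of_nonneg_left h2 (by positivity))
      _ = B * q ^ n * (n * K) / u N * u N := by field_simp
      _ ≤ B * q ^ n * (n * K) / u N * (C * r ^ n * u n) :=
          mul_le_mul_of_nonneg_left h3 (by positivity)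
      _ = _ := by rw [mul_pow]; ring
  have h1 := herr.add (tendsto_qRenewal_div hψ0 hψ hsum hu hunn hpos h hq hq1)
  have h2 := h1.mul (tendsto_div_add hne h 1)
  rw [zero_add, mul_one] at h2
  rw [← tendsto_add_atTop_iff_nat 1]
  refine h2.congr' ?_
  filter_upwards [hne] with n hn
  rw [← add_div, sub_add_cancel]
  exact div_mul_div_cancel₀ hn

end Asymptotics

/-! ### Asymptotics of the coefficients in `q`. -/

section Coefficientwise

variable {ψ : ℝ⟦X⟧}

theorem isUnit_one_sub_X_pow (m : ℕ) (hm : m ≠ 0) :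
    IsUnit (1 - (PowerSeries.X : ℝ⟦X⟧) ^ m) := by
  rw [PowerSeries.isUnit_iff_constantCoeff]
  simp [hm]

theorem constantCoeff_map_C (hψ0 : PowerSeries.constantCoeff ψ = 0) :
    PowerSeries.constantCoeff (PowerSeries.map (PowerSeries.C (R := ℝ)) ψ) = 0 := by
  rw [← PowerSeries.coeff_zero_eq_constantCoeff_apply, PowerSeries.coeff_map,
    PowerSeries.coeff_zero_eq_constantCoeff_apply, hψ0, map_zero]

/-- The `n`-th coefficient of `1 / ∏_{i ≥ 0} (1 - ψ(qⁱ w))`, as a power series in `q`. -/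
noncomputable def renewalSeries (ψ : ℝ⟦X⟧) (n : ℕ) : ℝ⟦X⟧ :=
  qRenewal PowerSeries.X (PowerSeries.map PowerSeries.C ψ) n

/-- The expansion of `1 / ∏_{i ≥ 1} (1 - ψ(qⁱ))` in powers of `q`. -/
noncomputable def limitSeries (ψ : ℝ⟦X⟧) : ℝ⟦X⟧ :=
  PowerSeries.mk fun j => ∑ p ∈ Finset.HasAntidiagonal.antidiagonal j,
    PowerSeries.coeff p.2 (renewalSeries ψ p.1)

/-- In `cₙ = ∑ u_{n-i} qⁱ cᵢ` the terms with `i > j` do not reach `q^j`. The number of terms left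
does not depend on `n`, so limits pass termwise. -/
theorem coeff_renewalSeries (hψ0 : PowerSeries.constantCoeff ψ = 0) {n j : ℕ} (hj : j ≤ n) :
    PowerSeries.coeff j (renewalSeries ψ n) = ∑ p ∈ Finset.HasAntidiagonal.antidiagonal j,
      PowerSeries.coeff (n - p.1) (1 - ψ)⁻¹ * PowerSeries.coeff p.2 (renewalSeries ψ p.1) := by
  have hinv : (1 - ψ)⁻¹ * (1 - ψ) = 1 := PowerSeries.inv_mul_cancel _ (by simp [hψ0])
  have hW : PowerSeries.map (PowerSeries.C (R := ℝ)) (1 - ψ)⁻¹ *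
      (1 - PowerSeries.map PowerSeries.C ψ) = 1 := by
    rw [← map_one (PowerSeries.map (PowerSeries.C (R := ℝ))), ← map_sub, ← map_mul, hinv]
  rw [renewalSeries, qRenewal_eq_sum isUnit_one_sub_X_pow (constantCoeff_map_C hψ0) hW, map_sum,
    Finset.Nat.sum_antidiagonal_eq_sum_range_succ_mk]
  symm
  refine Eq.trans ?_ (Finset.sum_subset (Finset.range_subset_range.2 (Nat.succ_le_succ hj)) ?_)
  · refine Finset.sum_congr rfl fun i hi => ?_
    rw [PowerSeries.coeff_map, PowerSeries.coeff_C_mul, PowerSeries.coeff_X_pow_mul',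
      if_pos (Nat.lt_succ_iff.1 (Finset.mem_range.1 hi))]
    rfl
  · intro i _ hi
    rw [PowerSeries.coeff_map, PowerSeries.coeff_C_mul, PowerSeries.coeff_X_pow_mul',
      if_neg (by simpa using hi), mul_zero]

theorem coeff_qInv_X (hψ0 : PowerSeries.constantCoeff ψ = 0) {n j : ℕ} (hj : j < n) :
    PowerSeries.coeff j (qInv (PowerSeries.X : ℝ⟦X⟧) (PowerSeries.map PowerSeries.C ψ) (n + 1)) =
      PowerSeries.coeff j (renewalSeries ψ n) := by
  rw [qInv_succ isUnit_one_sub_X_pow (constantCoeff_map_C hψ0), map_sub, map_sum,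
    Finset.sum_eq_zero, sub_zero]
  · rfl
  intro k hk
  have hk' := Finset.mem_range.1 hk
  have h1 : n ≤ (k + 1) * (n - k) := by
    obtain ⟨l, rfl⟩ : ∃ l, n = k + 1 + l := ⟨n - (k + 1), by omega⟩
    rw [show k + 1 + l - k = l + 1 by omega]
    nlinarith [Nat.zero_le (k * l)]
  refine PowerSeries.X_pow_dvd_iff.1 ?_ j hj
  exact Dvd.dvd.mul_left (Dvd.dvd.mul_right (pow_dvd_pow _ h1) _) _

theorem tendsto_coeff_qInv_div (hψ0 : PowerSeries.constantCoeff ψ = 0) {u : ℕ → ℝ}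
    (hu : ∀ n, u n = PowerSeries.coeff n (1 - ψ)⁻¹) (hne : ∀ᶠ n in atTop, u n ≠ 0)
    (h : Tendsto (fun n => u (n + 1) / u n) atTop (𝓝 1)) (j : ℕ) :
    Tendsto (fun n => PowerSeries.coeff j
      (qInv (PowerSeries.X : ℝ⟦X⟧) (PowerSeries.map PowerSeries.C ψ) n) / u n) atTop
      (𝓝 (PowerSeries.coeff j (limitSeries ψ))) := by
  rw [← tendsto_add_atTop_iff_nat 1]
  have h1 : Tendsto (fun n => ∑ p ∈ Finset.HasAntidiagonal.antidiagonal j,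
      u (n - p.1) / u n * (u n / u (n + 1)) * PowerSeries.coeff p.2 (renewalSeries ψ p.1)) atTop
      (𝓝 (∑ p ∈ Finset.HasAntidiagonal.antidiagonal j,
        1 * 1 * PowerSeries.coeff p.2 (renewalSeries ψ p.1))) :=
    tendsto_finsetSum _ fun p _ =>
      ((tendsto_sub_div hne h p.1).mul (tendsto_div_add hne h 1)).mul_const _
  simp only [one_mul] at h1
  rw [limitSeries, PowerSeries.coeff_mk]
  refine h1.congr' ?_
  filter_upwards [eventually_gt_atTop j, hne] with n hn hn0
  rw [coeff_qInv_X hψ0 hn, coeff_renewalSeries hψ0 hn.le, Finset.sum_div]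
  refine Finset.sum_congr rfl fun p _ => ?_
  rw [div_mul_div_cancel₀ hn0, ← hu]
  ring

end Coefficientwise

/-! ### Expansions in `q` with nonnegative coefficients. -/

section Evaluation

/-- `F` has nonnegative coefficients and its series at `q` has the sum `a`. -/
def HasNonnegSum (q : ℝ) (F : ℝ⟦X⟧) (a : ℝ) : Prop :=
  (∀ k, 0 ≤ PowerSeries.coeff k F) ∧ HasSum (fun k => PowerSeries.coeff k F * q ^ k) a

theorem HasNonnegSum.mul {q : ℝ} {F G : ℝ⟦X⟧} {a b : ℝ} (hF : HasNonnegSum q F a)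
    (hG : HasNonnegSum q G b) : HasNonnegSum q (F * G) (a * b) := by
  refine ⟨fun k => ?_, ?_⟩
  · rw [PowerSeries.coeff_mul]
    exact Finset.sum_nonneg fun p _ => mul_nonneg (hF.1 _) (hG.1 _)
  have h1 := summable_norm_sum_mul_antidiagonal_of_summable_norm hF.2.summable.norm
    hG.2.summable.norm
  have e : ∀ n, ∑ kl ∈ Finset.HasAntidiagonal.antidiagonal n,
      PowerSeries.coeff kl.1 F * q ^ kl.1 * (PowerSeries.coeff kl.2 G * q ^ kl.2) =
      PowerSeries.coeff n (F * G) * q ^ n := by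
    intro n
    rw [PowerSeries.coeff_mul, Finset.sum_mul]
    refine Finset.sum_congr rfl fun p hp => ?_
    rw [← Finset.HasAntidiagonal.mem_antidiagonal.1 hp, pow_add]
    ring
  simp only [e] at h1
  have h2 := psValue_mul hF.2.summable.norm hG.2.summable.norm
  rw [psValue, psValue, psValue, hF.2.tsum_eq, hG.2.tsum_eq] at h2
  rw [← h2]
  exact h1.of_norm.hasSum

theorem hasNonnegSum_one (q : ℝ) : HasNonnegSum q 1 1 := by
  refine ⟨fun k => ?_, ?_⟩
  · rw [PowerSeries.coeff_one]; split_ifs <;> simp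
  · convert hasSum_ite_eq (0 : ℕ) (1 : ℝ) using 2 with n
    rw [PowerSeries.coeff_one]
    split_ifs with hn <;> simp [hn]

theorem hasNonnegSum_inverse {q : ℝ} (hq : 0 ≤ q) (hq1 : q < 1) {m : ℕ} (hm : m ≠ 0) :
    HasNonnegSum q (Ring.inverse (1 - (PowerSeries.X : ℝ⟦X⟧) ^ m)) (1 - q ^ m)⁻¹ := by
  set G : ℝ⟦X⟧ := PowerSeries.mk fun k => if m ∣ k then 1 else 0 with hG
  have h1 : G * (1 - (PowerSeries.X : ℝ⟦X⟧) ^ m) = 1 := by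
    ext k
    rw [mul_sub, mul_one, map_sub, PowerSeries.coeff_mul_X_pow', PowerSeries.coeff_one, hG]
    simp only [PowerSeries.coeff_mk]
    by_cases hk : m ≤ k
    · have hd : (m ∣ k - m) ↔ m ∣ k := by
        rw [← Nat.dvd_add_self_right, Nat.sub_add_cancel hk]
      simp only [if_pos hk, hd]
      rw [sub_self, if_neg (by omega)]
    · rw [if_neg hk, sub_zero]
      by_cases hk0 : k = 0
      · simp [hk0]
      · rw [if_neg hk0, if_neg fun hd => hk (Nat.le_of_dvd (by omega) hd)]
  have h2 : Ring.inverse (1 - (PowerSeries.X : ℝ⟦X⟧) ^ m) = G := by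
    have hu := isUnit_one_sub_X_pow m hm
    exact left_inv_eq_right_inv (Ring.inverse_mul_cancel _ hu) (by rw [mul_comm, h1])
  rw [h2]
  refine ⟨fun k => ?_, ?_⟩
  · rw [hG, PowerSeries.coeff_mk]; split_ifs <;> simp
  have hinj : Function.Injective fun i : ℕ => m * i := fun a b hab =>
    Nat.eq_of_mul_eq_mul_left (Nat.pos_of_ne_zero hm) hab
  have h3 : HasSum ((fun k => PowerSeries.coeff k G * q ^ k) ∘ fun i : ℕ => m * i)
      (1 - q ^ m)⁻¹ := by
    convert hasSum_geometric_of_lt_one (pow_nonneg hq m) (pow_lt_one₀ hq hq1 hm) using 2 with i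
    rw [Function.comp, hG, PowerSeries.coeff_mk, if_pos (dvd_mul_right m i), one_mul, pow_mul]
  refine (hinj.hasSum_iff fun k hk => ?_).1 h3
  rw [hG, PowerSeries.coeff_mk, if_neg, zero_mul]
  rintro ⟨i, rfl⟩
  exact hk ⟨i, rfl⟩

theorem hasNonnegSum_renewalSeries {ψ : ℝ⟦X⟧} (hψ : ∀ i, 0 ≤ PowerSeries.coeff i ψ) {q : ℝ}
    (hq : 0 ≤ q) (hq1 : q < 1) (m : ℕ) :
    HasNonnegSum q (renewalSeries ψ m) (qRenewal q ψ m) := by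
  induction m using Nat.strong_induction_on with
  | _ m ih =>
    rcases eq_or_ne m 0 with rfl | hm
    · rw [renewalSeries, qRenewal_zero, qRenewal_zero]
      exact hasNonnegSum_one q
    rw [renewalSeries, qRenewal_eq _ _ hm, qRenewal_real_eq hm]
    refine (hasNonnegSum_inverse hq hq1 hm).mul ⟨fun k => ?_, ?_⟩
    · rw [map_sum]
      refine Finset.sum_nonneg fun i hi => ?_
      rw [PowerSeries.coeff_map, PowerSeries.coeff_C_mul]
      exact mul_nonneg (hψ _) ((ih i (Finset.mem_range.1 hi)).1 k)
    · have := hasSum_sum fun i (hi : i ∈ Finset.range m) =>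
        (ih i (Finset.mem_range.1 hi)).2.mul_left (PowerSeries.coeff (m - i) ψ)
      refine this.congr_fun ?_
      intro k
      rw [map_sum, Finset.sum_mul]
      refine Finset.sum_congr rfl fun i _ => ?_
      rw [PowerSeries.coeff_map, PowerSeries.coeff_C_mul, mul_assoc]
      rfl

/-- The nonnegative double series of the terms of `cᵢ(q) qⁱ` is summed in two ways: by rows it gives
`H(q)`, by antidiagonals the expansion in powers of `q`. -/
theorem hasSum_limitSeries {ψ : ℝ⟦X⟧} (hψ : ∀ i, 0 ≤ PowerSeries.coeff i ψ)
    (hsum : HasSum (fun n => PowerSeries.coeff n ψ) 1) {q : ℝ} (hq : 0 ≤ q) (hq1 : q < 1) :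
    HasSum (fun k => PowerSeries.coeff k (limitSeries ψ) * q ^ k)
      (psValue (PowerSeries.mk (qRenewal q ψ)) q) := by
  let f : ℕ × ℕ → ℝ := fun p => PowerSeries.coeff p.2 (renewalSeries ψ p.1) * q ^ p.2 * q ^ p.1
  have hev := hasNonnegSum_renewalSeries hψ hq hq1
  have hrow : ∀ i, HasSum (fun l => f (i, l)) (qRenewal q ψ i * q ^ i) := fun i =>
    (hev i).2.mul_right (q ^ i)
  have hf0 : 0 ≤ f := fun p =>
    mul_nonneg (mul_nonneg ((hev p.1).1 p.2) (pow_nonneg hq _)) (pow_nonneg hq _)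
  have hs := summable_qRenewal hψ hsum hq hq1 hq hq1
  have hf : Summable f := (summable_prod_of_nonneg hf0).2
    ⟨fun i => (hrow i).summable, by simpa only [(hrow _).tsum_eq] using hs⟩
  have h1 := hf.hasSum.prod_fiberwise hrow
  have h2 := (Finset.HasAntidiagonal.sigmaAntidiagonalEquivProd.hasSum_iff).2 hf.hasSum
  have h3 := h2.sigma fun n => hasSum_fintype _
  rw [psValue_mk_qRenewal, h1.tsum_eq]
  refine h3.congr_fun ?_
  intro n
  rw [limitSeries, PowerSeries.coeff_mk, Finset.sum_mul, ← Finset.sum_coe_sort]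
  refine Finset.sum_congr rfl fun p _ => ?_
  have := Finset.HasAntidiagonal.mem_antidiagonal.1 p.2
  simp only [Function.comp, f, Finset.HasAntidiagonal.sigmaAntidiagonalEquivProd_apply]
  rw [mul_assoc, ← pow_add, add_comm, this]

end Evaluation

/-! ### From pointwise convergence to senses (a) and (b). -/

section Convergence

theorem convergesLiminf_of_tendsto {a : ℕ → ℝ[X]} {L : ℝ⟦X⟧} {A : Set ℝ}
    (h : ∀ q ∈ A, Tendsto (fun n => (a n).eval q) atTop (𝓝 (psValue L q))) :
    ConvergesLiminf a L A := fun q hq =>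
  ((continuous_coe_real_ereal.tendsto _).comp (h q hq)).liminf_eq

theorem convergesOffDensityZero_of_tendsto {a : ℕ → ℝ[X]} {L : ℝ⟦X⟧} {A : Set ℝ}
    (h : ∀ q ∈ A, Tendsto (fun n => (a n).eval q) atTop (𝓝 (psValue L q))) :
    ConvergesOffDensityZero a L A := by
  classical
  intro δ hδ q hq
  have h1 : Tendsto (fun i => if δ ≤ |(a i).eval q - psValue L q| then (1 : ℝ) else 0) atTop
      (𝓝 0) := by
    refine tendsto_const_nhds.congr' ?_
    filter_upwards [(Metric.tendsto_nhds.1 (h q hq)) δ hδ] with i hi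
    rw [if_neg (not_le.2 (by rwa [Real.dist_eq] at hi))]
  -- The proportion is the Cesàro mean of indicators that are eventually 0; the shift makes the
  -- index start at 1.
  have h2 := ((tendsto_add_atTop_iff_nat 1).2 h1).cesaro
  refine h2.congr fun n => ?_
  rw [one_div, Finset.range_eq_Ico, Finset.sum_Ico_add' (fun i =>
    if δ ≤ |(a i).eval q - psValue L q| then (1 : ℝ) else 0) 0 n 1]
  congr 1

end Convergence

/-! ### The polynomials `q^(n choose 2) gₙ` and the conclusion. -/

theorem isQRightInverse_of_qInv {q : ℝ} (hq : q ≠ 0) {φ : ℝ⟦X⟧}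
    (hφ : PowerSeries.constantCoeff φ = 0) :
    IsQRightInverse q (PowerSeries.X * (1 - φ))
      (PowerSeries.mk fun n => (q ^ n.choose 2)⁻¹ * qInv q φ n) := by
  set g : ℝ⟦X⟧ := PowerSeries.mk fun n => (q ^ n.choose 2)⁻¹ * qInv q φ n with hg
  have hg0 : PowerSeries.constantCoeff g = 0 := by
    rw [← PowerSeries.coeff_zero_eq_constantCoeff_apply, hg, PowerSeries.coeff_mk, qInv_zero,
      mul_zero]
  refine ⟨hg0, fun m => sum_coeff_prod_rescale_inv hq (by simp) ?_ hg0
    (qComp_X_mul_one_sub hφ g fun n => ?_) m⟩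
  · rw [PowerSeries.coeff_succ_X_mul 0, PowerSeries.coeff_zero_eq_constantCoeff_apply, map_sub,
      map_one, hφ, sub_zero]
    exact one_ne_zero
  · rw [hg, PowerSeries.coeff_mk, mul_inv_cancel_left₀ (pow_ne_zero _ hq)]

/-- The polynomial `q ^ (n choose 2) gₙ` in `q`. -/
noncomputable def qInvPoly (φ : ℝ⟦X⟧) (n : ℕ) : ℝ[X] :=
  qInv Polynomial.X (PowerSeries.map Polynomial.C φ) n

theorem eval_qInvPoly (φ : ℝ⟦X⟧) (q : ℝ) (n : ℕ) : (qInvPoly φ n).eval q = qInv q φ n := by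
  have h := map_qInv (Polynomial.evalRingHom q) Polynomial.X (PowerSeries.map Polynomial.C φ) n
  rw [Polynomial.coe_evalRingHom, Polynomial.eval_X] at h
  rw [qInvPoly, h]
  congr 1
  ext k
  simp

theorem coeff_qInvPoly (φ : ℝ⟦X⟧) (j n : ℕ) : (qInvPoly φ n).coeff j =
    PowerSeries.coeff j (qInv (PowerSeries.X : ℝ⟦X⟧) (PowerSeries.map PowerSeries.C φ) n) := by
  have h := map_qInv (Polynomial.coeToPowerSeries.ringHom (R := ℝ)) Polynomial.X
    (PowerSeries.map Polynomial.C φ) n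
  rw [Polynomial.coeToPowerSeries.ringHom_apply, Polynomial.coeToPowerSeries.ringHom_apply,
    Polynomial.coe_X] at h
  have e : PowerSeries.map (Polynomial.coeToPowerSeries.ringHom (R := ℝ))
      (PowerSeries.map Polynomial.C φ) = PowerSeries.map PowerSeries.C φ := by
    ext1 k
    rw [PowerSeries.coeff_map, PowerSeries.coeff_map, PowerSeries.coeff_map,
      Polynomial.coeToPowerSeries.ringHom_apply, Polynomial.coe_C]
  rw [← Polynomial.coeff_coe, qInvPoly, h, e]

theorem theorem2p4 (φ : ℝ⟦X⟧) (ζ ρ : ℝ)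
    (hφ_zero : PowerSeries.constantCoeff φ = 0)
    (hφ_nonneg : ∀ i : ℕ, 1 ≤ i → 0 ≤ PowerSeries.coeff i φ)
    (hζ : IsLeast {x : ℝ | 0 < x ∧ HasSum (fun n : ℕ => PowerSeries.coeff n φ * x ^ n) 1} ζ)
    (hφ_ratio : ∀ j : ℕ, ∃ r : ℝ, 0 ≤ r ∧
      Tendsto (fun n : ℕ => PowerSeries.coeff (j + n) φ / PowerSeries.coeff n φ) atTop (𝓝 r))
    (hρ : ρ ∈ Set.Ioc (0 : ℝ) 1)
    (hφ_rv : IsRegularlyVaryingSeq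
      (fun n : ℕ => PowerSeries.coeff n (1 - PowerSeries.rescale ζ φ)⁻¹) (ρ - 1)) :
    -- `P n` is the polynomial `q ^ (n choose 2) gₙ` in `q`
    -- `L` is the expansion in powers of `q` of `ζ / (Γ(ρ) ∏_{j ≥ 1} (1 - φ(ζ q ^ j)))`
    ∃ (P : ℕ → ℝ[X]) (L : ℝ⟦X⟧),
      (∀ q ∈ Set.Ioo (0 : ℝ) 1,
        (∃! g : ℝ⟦X⟧, IsQRightInverse q (PowerSeries.X * (1 - φ)) g) ∧
        ∀ g : ℝ⟦X⟧, IsQRightInverse q (PowerSeries.X * (1 - φ)) g →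
          ∀ n : ℕ, (P n).eval q = q ^ (n.choose 2) * PowerSeries.coeff n g) ∧
      (∀ q ∈ Set.Ioo (0 : ℝ) 1,
        Multipliable (fun j : ℕ => 1 - psValue φ (ζ * q ^ (j + 1))) ∧
        0 < ∏' j : ℕ, (1 - psValue φ (ζ * q ^ (j + 1))) ∧
        HasSum (fun k : ℕ => PowerSeries.coeff k L * q ^ k)
          (ζ / (Real.Gamma ρ * ∏' j : ℕ, (1 - psValue φ (ζ * q ^ (j + 1)))))) ∧
      let a : ℕ → ℝ[X] := fun n =>
        Polynomial.C (ζ ^ n * (n : ℝ) * (1 - psValue φ (ζ * (1 - 1 / (n : ℝ))))) * P n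
      ConvergesLiminf a L (Set.Ioo 0 1) ∧
        ConvergesOffDensityZero a L (Set.Ioo 0 1) ∧
        ConvergesCoeffwise a L := by
  obtain ⟨hζ0, hζsum⟩ := hζ.1
  set ψ : ℝ⟦X⟧ := PowerSeries.rescale ζ φ with hψdef
  have hcoeff : ∀ n, PowerSeries.coeff n ψ = PowerSeries.coeff n φ * ζ ^ n := fun n => by
    rw [hψdef, PowerSeries.coeff_rescale, mul_comm]
  have hψ0 : PowerSeries.constantCoeff ψ = 0 := by
    rw [← PowerSeries.coeff_zero_eq_constantCoeff_apply, hcoeff,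
      PowerSeries.coeff_zero_eq_constantCoeff_apply, hφ_zero, zero_mul]
  have hψ : ∀ i, 0 ≤ PowerSeries.coeff i ψ := by
    intro i
    rcases i.eq_zero_or_pos with rfl | hi
    · rw [PowerSeries.coeff_zero_eq_constantCoeff_apply, hψ0]
    · rw [hcoeff]; exact mul_nonneg (hφ_nonneg i hi) (pow_nonneg hζ0.le i)
  have hsum : HasSum (fun n => PowerSeries.coeff n ψ) 1 := by simpa only [hcoeff] using hζsum
  have hval : ∀ x, psValue φ (ζ * x) = psValue ψ x := fun x => (psValue_rescale φ ζ x).symm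
  set u : ℕ → ℝ := fun n => PowerSeries.coeff n (1 - ψ)⁻¹ with hu
  have hunn : ∀ n, 0 ≤ u n := fun n => by
    rw [hu]
    simp only [coeff_inv_one_sub hψ0]
    exact qRenewal_nonneg hψ le_rfl zero_lt_one n
  have hpos := hφ_rv.eventually_pos hunn
  have hne := hφ_rv.eventually_ne_zero
  have hsucc := hφ_rv.tendsto_succ_div
  have hnorm := tendsto_norming hρ hψ0 hψ hsum hφ_rv
  have hf1 : PowerSeries.coeff 1 (PowerSeries.X * (1 - φ)) ≠ 0 := by
    rw [PowerSeries.coeff_succ_X_mul 0, PowerSeries.coeff_zero_eq_constantCoeff_apply, map_sub,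
      map_one, hφ_zero, sub_zero]
    exact one_ne_zero
  set L : ℝ⟦X⟧ := PowerSeries.C (ζ / Real.Gamma ρ) * limitSeries ψ with hL
  have hLsum : ∀ q ∈ Set.Ioo (0 : ℝ) 1, HasSum (fun k : ℕ => PowerSeries.coeff k L * q ^ k)
      (ζ / Real.Gamma ρ * psValue (PowerSeries.mk (qRenewal q ψ)) q) := fun q hq => by
    refine ((hasSum_limitSeries hψ hsum hq.1.le hq.2).mul_left (ζ / Real.Gamma ρ)).congr_fun ?_
    intro k
    rw [hL, PowerSeries.coeff_C_mul, mul_assoc]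
  set a : ℕ → ℝ[X] := fun n =>
    Polynomial.C (ζ ^ n * (n : ℝ) * (1 - psValue φ (ζ * (1 - 1 / (n : ℝ))))) * qInvPoly φ n with ha
  have hlim : ∀ q ∈ Set.Ioo (0 : ℝ) 1,
      Tendsto (fun n => (a n).eval q) atTop (𝓝 (psValue L q)) := by
    intro q hq
    have h1 := (hnorm.mul (tendsto_qInv_div hψ0 hψ hsum (fun _ => rfl) hunn hpos hsucc
      hq.1 hq.2)).const_mul ζ
    rw [psValue, (hLsum q hq).tsum_eq, div_eq_mul_inv, mul_assoc]
    refine h1.congr' ?_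
    -- The factor `uₙ` cancels between the norming limit and `bₙ/uₙ`, and `ζⁿ bₙ(φ) = ζ bₙ(ψ)`
    -- restores `φ`.
    filter_upwards [hne] with n hn
    have e := pow_mul_qInv q ζ φ n
    rw [← hψdef] at e
    rw [ha]
    simp only [Polynomial.eval_mul, Polynomial.eval_C, eval_qInvPoly, hval]
    have hn' : PowerSeries.coeff n (1 - ψ)⁻¹ ≠ 0 := hn
    calc _ = (n : ℝ) * (1 - psValue ψ (1 - 1 / (n : ℝ))) * (ζ * qInv q ψ n) := by
          field_simp
      _ = _ := by rw [← e]; ring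
  refine ⟨qInvPoly φ, L, fun q hq => ?_, fun q hq => ?_, convergesLiminf_of_tendsto hlim,
    convergesOffDensityZero_of_tendsto hlim, fun j => ?_⟩
  · have hinv := isQRightInverse_of_qInv hq.1.ne' hφ_zero
    refine ⟨⟨_, hinv, fun g hg => hg.unique hf1 hinv⟩, fun g hg n => ?_⟩
    rw [hg.unique hf1 hinv, PowerSeries.coeff_mk, eval_qInvPoly,
      mul_inv_cancel_left₀ (pow_ne_zero _ hq.1.ne')]
  · simp only [hval]
    have hH := one_le_psValue_qRenewal hψ hsum hq.1.le hq.2 hq.1.le hq.2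
    refine ⟨multipliable_one_sub_psValue hψ0 hψ hsum hq.1.le hq.2, ?_, ?_⟩
    · rw [tprod_one_sub_psValue hψ0 hψ hsum hq.1.le hq.2]
      exact inv_pos.2 (by linarith)
    · rw [tprod_one_sub_psValue hψ0 hψ hsum hq.1.le hq.2, ← div_div, div_inv_eq_mul]
      exact hLsum q hq
  · have h1 := (hnorm.mul (tendsto_coeff_qInv_div hψ0 (fun _ => rfl) hne hsucc j)).const_mul ζ
    rw [hL, PowerSeries.coeff_C_mul, div_eq_mul_inv, mul_assoc]
    refine h1.congr' ?_
    filter_upwards [hne] with n hn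
    have e := pow_mul_qInv (PowerSeries.X : ℝ⟦X⟧) (PowerSeries.C ζ)
      (PowerSeries.map PowerSeries.C φ) n
    have e1 : PowerSeries.rescale (PowerSeries.C ζ) (PowerSeries.map (PowerSeries.C (R := ℝ)) φ) =
        PowerSeries.map PowerSeries.C ψ := by
      ext1 k
      rw [PowerSeries.coeff_rescale, PowerSeries.coeff_map, PowerSeries.coeff_map, hψdef,
        PowerSeries.coeff_rescale, map_mul, map_pow]
    have e2 := congrArg (PowerSeries.coeff j) e
    rw [e1, ← map_pow, PowerSeries.coeff_C_mul, PowerSeries.coeff_C_mul] at e2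
    simp only [Polynomial.coeff_C_mul, coeff_qInvPoly, hval]
    have hn' : PowerSeries.coeff n (1 - ψ)⁻¹ ≠ 0 := hn
    calc _ = (n : ℝ) * (1 - psValue ψ (1 - 1 / (n : ℝ))) * (ζ * PowerSeries.coeff j
            (qInv (PowerSeries.X : ℝ⟦X⟧) (PowerSeries.map PowerSeries.C ψ) n)) := by
          field_simp
      _ = _ := by rw [← e2]; ring
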